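/- \textbf{Setting.} Write $\leqq$ for the coordinatewise order on $\mathbb{R}^2$, $\mathbb{R}_+=(0,\infty)$, $[z,\infty)=\{x\in\mathbb{R}^2: z\leqq x\}$, and let $\mathrm{dist}$ be the Euclidean distance. Let $\Gamma$ be a continuous strictly decreasing curve in $[0,1]^2$ (the graph of a continuous strictly decreasing function on $[0,1]$) with endpoints $(1,0)$ and $(0,1)$, and let $\Omega$ be the bounded component of $[0,\infty)^2\setminus\Gamma$. Let $\{\Gamma_i\}_{i\in\mathbb{Z}}$ be a locally finite family of pairwise disjoint continuous strictly increasing curves (graphs of continuous strictly increasing functions over intervals), each containing its lower left endpoint, which lies on $\partial([0,\infty)^2\setminus\Omega)$, and each unbounded. Let $\{\Omega_i\}_{i\in\mathbb{Z}}$ be the connected components of $([0,\infty)^2\setminus\Omega)\setminus\bigcup_i\Gamma_i$, labelled so that $\Gamma_i$ is contained in the boundary of exactly the two components $\Omega_i$ and $\Omega_{i-1}$. For $\theta\ge 0$ put $\Omega_\theta=\{x\in\Omega:\mathrm{dist}(x,\Gamma)>\theta\}$ and $\Omega_{i,\theta}=\{x\in\Omega_i:\mathrm{dist}(x,\Gamma_i)>\theta,\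 \mathrm{dist}(x,\Gamma_{i+1})>\theta\}$. A function $h:[0,\infty)^2\to[0,\infty)$ satisfies (F1) if it is bounded and upper semicontinuous, $h=0$ on $\Omega$, and there is a constant $C$ such that $h|_{\Omega_i}$ is Lipschitz with constant $C$ for every $i$. It satisfies (F1*) with parameter $\theta$, Lipschitz constant $C$ and bound $M$ if $h\le M$, $h$ is upper semicontinuous, $h=0$ on $\Omega_\theta$, and $h|_{\Omega_{i,\theta}}$ is Lipschitz with constant $C$ for every $i$. Two functions $h_1,h_2$ simultaneously satisfy (F3) if for every $i$ and $x\in\Gamma_i$ there are $\varepsilon>0$ and $\zeta\in\{-1,+1\}$ such that for $h=h_1$ and $h=h_2$ and all $y\in B_\varepsilon(x)\cap\Gamma_i$, \[\zeta\Big(\lim_{\Omega_{i-1}\ni w\to y}h(w)-\lim_{\Omega_i\ni w\to y}h(w)\Big)\ge 0 .\] For bounded Borel functions $\mu,\sigma:[0,\infty)^2\to[0,\infty)$ and $x\leqq y$ in $[0,\infty)^2$ let \[W_{\mu,\sigma}(x,y)=\sup_\gamma\int_0^1 \mu(\gamma(t))(\gamma_1'(t)+\gamma_2'(t))+2\sigma(\gamma(t))\sqrt{\gamma_1'(t)\gamma_2'(t)}\,dt,\]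 the supremum being over all $\gamma\in C^1([0,1];[0,\infty)^2)$ with $\gamma_1',\gamma_2'\ge0$, $\gamma(0)=x$, $\gamma(1)=y$. Let $h_*$ and $h^*$ denote the lower and upper semicontinuous envelopes of $h$. \textbf{Theorem.} Let $\mu,\sigma:[0,\infty)^2\to[0,\infty)$ be such that $\mu$ and $\sigma^2$ both satisfy (F1) and simultaneously satisfy (F3), such that on each $\Gamma_i$ the value of $\mu$ is the larger of its two one-sided limits from $\Omega_{i-1}$ and $\Omega_i$, and likewise for $\sigma^2$, and such that $\mu(x)=0$ whenever $x\in\mathbb{R}_+^2$ and $\sigma(x)=0$. For $k\ge1$ let $\mu_k,\sigma_k:[0,\infty)^2\to[0,\infty)$ be such that $\mu_k$ and $\sigma_k^2$ are Lipschitz on $[0,\infty)^2$ (with constants that may depend on $k$) and satisfy (F1*) with $\theta=1/k$, with a Lipschitz constant $C$ and a bound $M$ that do not depend on $k$. Suppose that for all $x\in\mathbb{R}_+^2$ \[\mu_*(x)\le\liminf_{k\to\infty,\ y\to x}\mu_k(y),\qquad \mu^*(x)\ge\limsup_{k\to\infty,\ y\to x}\mu_k(y),\] \[\sigma_*(x)\le\liminf_{k\to\infty,\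 y\to x}\sigma_k(y),\qquad \sigma^*(x)\ge\limsup_{k\to\infty,\ y\to x}\sigma_k(y).\] Then for every $z\in[0,\infty)^2$, \[W_{\mu_k,\sigma_k}(z,\cdot)\longrightarrow W_{\mu,\sigma}(z,\cdot)\quad\text{locally uniformly on }[z,\infty).\] -/

import Mathlib

open Filter Topology Set

namespace DLPP

/-- The Euclidean plane. -/
abbrev Plane : Type := EuclideanSpace ℝ (Fin 2)

/-- The closed quadrant `[0,∞)²`. -/
def Quad : Set Plane := {x | ∀ j, 0 ≤ x j}

/-- The open quadrant `(0,∞)²`. -/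
def OpenQuad : Set Plane := {x | ∀ j, 0 < x j}

/-- The set `[z,∞)` of all points above `z` in the coordinatewise order. -/
def Above (z : Plane) : Set Plane := {x | ∀ j, z j ≤ x j}

/-- The curve `t ↦ (t, f t)`, `t ∈ I`, as a set of points. -/
def graphOver (I : Set ℝ) (f : ℝ → ℝ) : Set Plane := {x | x 0 ∈ I ∧ x 1 = f (x 0)}

/-- The bounded part (union of the bounded connected components; here there is exactly one) of the
complement of the curve `G` in the closed quadrant. -/
def boundedPart (G : Set Plane) : Set Plane :=
  {x | x ∈ Quad \ G ∧ Bornology.IsBounded (connectedComponentIn (Quad \ G) x)}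

/-- The geometric data: a continuous strictly decreasing curve `Γ` from `(0,1)` to `(1,0)`,
a locally finite family of pairwise disjoint continuous strictly increasing unbounded curves
`Γ_i` (`i ∈ ℤ`), each starting on the boundary of `[0,∞)² \ Ω`, where `Ω` is the bounded component
of `[0,∞)² \ Γ`, and a labelling `Ω_i` (`i ∈ ℤ`) of the connected components of
`[0,∞)² \ (Ω ∪ ⋃ Γ_i)` for which `Γ_i` lies on the boundary of exactly `Ω_i` and `Ω_{i-1}`. -/
structure Geometry where
  /-- `Γ` is the graph of `g` over `[0,1]`. -/
  g : ℝ → ℝ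
  g_cont : ContinuousOn g (Icc 0 1)
  g_anti : StrictAntiOn g (Icc 0 1)
  g_zero : g 0 = 1
  g_one : g 1 = 0
  /-- `Γ_i` is the graph of `f i` over the interval `I i`. -/
  I : ℤ → Set ℝ
  f : ℤ → ℝ → ℝ
  I_interval : ∀ i, (I i).OrdConnected
  f_cont : ∀ i, ContinuousOn (f i) (I i)
  f_mono : ∀ i, StrictMonoOn (f i) (I i)
  /-- The lower left endpoint of `Γ_i` is on the boundary of `[0,∞)² \ Ω`. -/
  f_start : ∀ i, ∃ a, IsLeast (I i) a ∧
    !₂[a, f i a] ∈ frontier (Quad \ boundedPart (graphOver (Icc 0 1) g))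
  f_unbounded : ∀ i, ¬ Bornology.IsBounded (graphOver (I i) (f i))
  curves_disjoint : Pairwise fun i j => Disjoint (graphOver (I i) (f i)) (graphOver (I j) (f j))
  curves_locallyFinite : LocallyFinite fun i => graphOver (I i) (f i)
  /-- The components `Ω_i`. -/
  region : ℤ → Set Plane
  region_component : ∀ i,
    ∃ x ∈ (Quad \ boundedPart (graphOver (Icc 0 1) g)) \ ⋃ j, graphOver (I j) (f j),
      region i = connectedComponentIn
        ((Quad \ boundedPart (graphOver (Icc 0 1) g)) \ ⋃ j, graphOver (I j) (f j)) x
  region_cover :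
    (Quad \ boundedPart (graphOver (Icc 0 1) g)) \ ⋃ j, graphOver (I j) (f j) ⊆ ⋃ i, region i
  region_label : ∀ i j, graphOver (I i) (f i) ⊆ frontier (region j) ↔ j = i ∨ j = i - 1

namespace Geometry

variable (D : Geometry)

/-- The decreasing curve `Γ`. -/
def Gam : Set Plane := graphOver (Icc 0 1) D.g

/-- The region `Ω` enclosed by `Γ` and the axes. -/
def Om : Set Plane := boundedPart D.Gam

/-- The increasing curve `Γ_i`. -/
def curve (i : ℤ) : Set Plane := graphOver (D.I i) (D.f i)

/-- `Ω_θ`. -/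
def OmTrim (θ : ℝ) : Set Plane := {x | x ∈ D.Om ∧ θ < Metric.infDist x D.Gam}

/-- `Ω_{i,θ}`. -/
def regionTrim (i : ℤ) (θ : ℝ) : Set Plane :=
  {x | x ∈ D.region i ∧ θ < Metric.infDist x (D.curve i) ∧
    θ < Metric.infDist x (D.curve (i + 1))}

end Geometry

/-- Condition (F1): `h` is a bounded upper semicontinuous function `[0,∞)² → [0,∞)` that vanishes
on `Ω` and is Lipschitz on the regions `Ω_i` with a common constant. -/
def F1 (D : Geometry) (h : Plane → ℝ) : Prop :=
  (∀ x ∈ Quad, 0 ≤ h x) ∧ (∃ M, ∀ x ∈ Quad, h x ≤ M) ∧ UpperSemicontinuousOn h Quad ∧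
    (∀ x ∈ D.Om, h x = 0) ∧ ∃ C, ∀ i, LipschitzOnWith C h (D.region i)

/-- Condition (F1*) with parameter `θ`, Lipschitz constant `C` and upper bound `M`. -/
def F1Star (D : Geometry) (θ : ℝ) (C : NNReal) (M : ℝ) (h : Plane → ℝ) : Prop :=
  (∀ x ∈ Quad, 0 ≤ h x) ∧ (∀ x ∈ Quad, h x ≤ M) ∧ UpperSemicontinuousOn h Quad ∧
    (∀ x ∈ D.OmTrim θ, h x = 0) ∧ ∀ i, LipschitzOnWith C h (D.regionTrim i θ)

/-- `ζ` times the jump of `h` across `Γ_i` at `y` (from `Ω_i` to `Ω_{i-1}`) is nonnegative. -/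
def SignedJumpNonneg (D : Geometry) (i : ℤ) (ζ : ℝ) (h : Plane → ℝ) (y : Plane) : Prop :=
  ∃ a b, Tendsto h (𝓝[D.region (i - 1)] y) (𝓝 a) ∧ Tendsto h (𝓝[D.region i] y) (𝓝 b) ∧
    0 ≤ ζ * (a - b)

/-- `h₁` and `h₂` satisfy (F3) simultaneously, that is, with the same sign `ζ` at each point. -/
def SimultaneousF3 (D : Geometry) (h₁ h₂ : Plane → ℝ) : Prop :=
  ∀ i, ∀ x ∈ D.curve i, ∃ ε > 0, ∃ ζ : ℝ, (ζ = 1 ∨ ζ = -1) ∧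
    ∀ y ∈ Metric.ball x ε ∩ D.curve i,
      SignedJumpNonneg D i ζ h₁ y ∧ SignedJumpNonneg D i ζ h₂ y

/-- On each `Γ_i` the value of `h` is the larger of its two one-sided limits. -/
def MaxOnCurves (D : Geometry) (h : Plane → ℝ) : Prop :=
  ∀ i, ∀ x ∈ D.curve i, ∃ a b, Tendsto h (𝓝[D.region (i - 1)] x) (𝓝 a) ∧
    Tendsto h (𝓝[D.region i] x) (𝓝 b) ∧ h x = max a b

/-- `C^{0,1}([0,∞)²)`: globally Lipschitz on the closed quadrant. -/
def LipschitzOnQuad (h : Plane → ℝ) : Prop := ∃ K, LipschitzOnWith K h Quad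

/-- For `x` in the open quadrant: `h_*(x) ≤ liminf h_k(y)` and `limsup h_k(y) ≤ h^*(x)` as
`k → ∞`, `y → x`, where `h_*`, `h^*` are the semicontinuous envelopes of `h`. -/
def RelaxedLimits (h : Plane → ℝ) (hk : ℕ → Plane → ℝ) : Prop :=
  ∀ x ∈ OpenQuad,
    liminf h (𝓝 x) ≤ liminf (fun p : ℕ × Plane => hk p.1 p.2) (atTop ×ˢ 𝓝 x) ∧
    limsup (fun p : ℕ × Plane => hk p.1 p.2) (atTop ×ˢ 𝓝 x) ≤ limsup h (𝓝 x)

/-- The class of monotone `C¹` curves `γ : [0,1] → [0,∞)²`. -/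
def MonotoneCurves : Set (ℝ → Plane) :=
  {γ | ContDiffOn ℝ 1 γ (Icc 0 1) ∧ (∀ t ∈ Icc (0 : ℝ) 1, γ t ∈ Quad) ∧
    ∀ t ∈ Icc (0 : ℝ) 1, ∀ j, 0 ≤ derivWithin γ (Icc 0 1) t j}

/-- `ℓ(x,p) = μ(x)(p₁ + p₂) + 2σ(x)√(p₁p₂)`. -/
noncomputable def ell (μ σ : Plane → ℝ) (x p : Plane) : ℝ :=
  μ x * (p 0 + p 1) + 2 * σ x * Real.sqrt (p 0 * p 1)

/-- The energy `J(γ) = ∫₀¹ ℓ(γ(t), γ'(t)) dt`. -/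
noncomputable def J (μ σ : Plane → ℝ) (γ : ℝ → Plane) : ℝ :=
  ∫ t in (0 : ℝ)..1, ell μ σ (γ t) (derivWithin γ (Icc 0 1) t)

/-- The value function `W(x,y)`, for `x ≤ y` coordinatewise in the closed quadrant. -/
noncomputable def W (μ σ : Plane → ℝ) (x y : Plane) : ℝ :=
  sSup {r | ∃ γ ∈ MonotoneCurves, γ 0 = x ∧ γ 1 = y ∧ J μ σ γ = r}

end DLPP

/-!
The value function `W` is compared with `W_k` from both sides by the same argument, in which the
two costs only enter through the relation `Dominates`: the one cost at a point is at most the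
other cost at any point displaced from it, within a fixed quadrant of directions and by a distance
of order `s`, up to an error `ε`.

*Shifting.* If `(μ', σ')` dominates `(μ, σ)` on a box in this sense, then a monotone curve can be
cut into steps of size `s`, shifted by `2 * s` in each coordinate, and clamped to the box spanned
by its endpoints. The chain of segments through the resulting points is an admissible competitor
for `W'`. Jensen's inequality on each step (`curve_integral_ell_le`) and the energy of a segment
(`box_le_W`) show that it loses little; clamping costs an error of order `s` and one of order
`√s`, because of the square root in `ell`. This is `integral_ell_le_W_of_dominates`. Local
comparisons are glued by the superadditivity of `W` (`W_superadditive`) along a subdivision whose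
number of pieces is bounded in terms of the coordinate sum `level`. Finitely many values of
`level` may be left out, since a monotone curve spends little length, hence little energy, near a
given level (`J_le_W_of_local`).

*Domination.* A point is good (`GoodAt`) when the costs `(μ_k, σ_k)` and `(μ, σ)` dominate each
other near it for large `k`. In the open quadrant this follows from the relaxed limits as soon as
`μ` and `σ ^ 2` increase, up to a modulus of continuity, along one common function `g` that is
strictly increasing in the directions of the displacement: `g` then separates the neighbourhoods
of the two points, which absorbs the blurring of `h_k` (`displacedClose_of_increasesAlong`).

*Geometry.* Across `Γ_i` the function `g` is the signed height over the curve, oriented towards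
the side with the larger limits. The common sign in `SimultaneousF3` says that `μ` and `σ ^ 2`
have the same larger side, and as `Γ_i` is strictly increasing the displacement to its upper left
or lower right serves (`goodAt_of_mem_curve`). Across `Γ`, which is strictly decreasing,
displacements to the upper right lead from `Ω`, where the costs vanish, into a region
(`goodAt_of_psi_zero`). At the remaining points the costs converge uniformly, on the axes by the
uniform Lipschitz bounds of `F1Star`. Only the endpoints of `Γ` and of the curves `Γ_i` are not
covered, and by local finiteness they occupy finitely many levels in any bounded set.
-/

namespace DLPP

/-! ### Monotone curves -/

section Curves

variable {γ : ℝ → Plane}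

lemma curve_hasDerivAt_coord (hγ : γ ∈ MonotoneCurves) {t : ℝ} (ht : t ∈ Ioo (0 : ℝ) 1)
    (j : Fin 2) :
    HasDerivAt (fun t => γ t j) (derivWithin γ (Icc 0 1) t j) t := by
  have h1 : HasDerivAt γ (derivWithin γ (Icc 0 1) t) t :=
    ((hγ.1.differentiableOn one_ne_zero t (Ioo_subset_Icc_self ht)).hasDerivWithinAt).hasDerivAt
      (Icc_mem_nhds ht.1 ht.2)
  exact (EuclideanSpace.proj (𝕜 := ℝ) j).hasFDerivAt.comp_hasDerivAt t h1

lemma curve_continuousOn_coord (hγ : γ ∈ MonotoneCurves) (j : Fin 2) :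
    ContinuousOn (fun t => γ t j) (Icc 0 1) :=
  (EuclideanSpace.proj (𝕜 := ℝ) j).continuous.comp_continuousOn hγ.1.continuousOn

lemma curve_continuousOn_deriv_coord (hγ : γ ∈ MonotoneCurves) (j : Fin 2) :
    ContinuousOn (fun t => derivWithin γ (Icc 0 1) t j) (Icc 0 1) :=
  (EuclideanSpace.proj (𝕜 := ℝ) j).continuous.comp_continuousOn
    (hγ.1.continuousOn_derivWithin (uniqueDiffOn_Icc one_pos) le_rfl)

lemma curve_intervalIntegrable_deriv_coord (hγ : γ ∈ MonotoneCurves) {a b : ℝ}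
    (ha : 0 ≤ a) (hab : a ≤ b) (hb : b ≤ 1) (j : Fin 2) :
    IntervalIntegrable (fun t => derivWithin γ (Icc 0 1) t j) MeasureTheory.volume a b := by
  apply ContinuousOn.intervalIntegrable
  rw [uIcc_of_le hab]
  exact (curve_continuousOn_deriv_coord hγ j).mono (Icc_subset_Icc ha hb)

lemma curve_integral_deriv_coord (hγ : γ ∈ MonotoneCurves) {a b : ℝ}
    (ha : 0 ≤ a) (hab : a ≤ b) (hb : b ≤ 1) (j : Fin 2) :
    ∫ t in a..b, derivWithin γ (Icc 0 1) t j = γ b j - γ a j :=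
  intervalIntegral.integral_eq_sub_of_hasDerivAt_of_le hab
    ((curve_continuousOn_coord hγ j).mono (Icc_subset_Icc ha hb))
    (fun _ ht => curve_hasDerivAt_coord hγ ⟨ha.trans_lt ht.1, ht.2.trans_le hb⟩ j)
    (curve_intervalIntegrable_deriv_coord hγ ha hab hb j)

lemma curve_coord_mono (hγ : γ ∈ MonotoneCurves) {a b : ℝ}
    (ha : 0 ≤ a) (hab : a ≤ b) (hb : b ≤ 1) (j : Fin 2) : γ a j ≤ γ b j := by
  have h := curve_integral_deriv_coord hγ ha hab hb j
  have : 0 ≤ ∫ t in a..b, derivWithin γ (Icc 0 1) t j :=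
    intervalIntegral.integral_nonneg hab fun t ht => hγ.2.2 t ⟨ha.trans ht.1, ht.2.trans hb⟩ j
  linarith

end Curves

/-! ### Admissible costs and the energy -/

/-- Pairs `(μ, σ)` of nonnegative upper semicontinuous functions on the quadrant bounded by `M`. -/
structure Admissible (M : ℝ) (μ σ : Plane → ℝ) : Prop where
  mu_nonneg : ∀ x ∈ Quad, 0 ≤ μ x
  sigma_nonneg : ∀ x ∈ Quad, 0 ≤ σ x
  mu_le : ∀ x ∈ Quad, μ x ≤ M
  sigma_le : ∀ x ∈ Quad, σ x ≤ M
  mu_usc : UpperSemicontinuousOn μ Quad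
  sigma_usc : UpperSemicontinuousOn σ Quad

lemma two_mul_sqrt_mul_le_add {x y : ℝ} (hx : 0 ≤ x) (hy : 0 ≤ y) :
    2 * Real.sqrt (x * y) ≤ x + y := by
  rw [Real.sqrt_mul hx]
  nlinarith [sq_nonneg (√x - √y), Real.sq_sqrt hx, Real.sq_sqrt hy]

/-- If `x` lies below every weighted arithmetic mean of `A` and `B`, it lies below their geometric
mean. -/
lemma two_mul_le_two_mul_sqrt_mul {x A B : ℝ} (hA : 0 ≤ A) (hB : 0 ≤ B)
    (h : ∀ l : ℝ, 0 < l → 2 * x ≤ l * A + B / l) : 2 * x ≤ 2 * Real.sqrt (A * B) := by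
  by_contra! hlt
  have hx : 0 < x := by
    have := Real.sqrt_nonneg (A * B)
    linarith
  have hx2 : A * B < x ^ 2 := (Real.sqrt_lt' hx).1 (by linarith)
  rcases hA.eq_or_lt with rfl | hA'
  · have hl : 0 < (B + 1) / x := by positivity
    have := h _ hl
    rw [div_div_eq_mul_div, mul_zero, zero_add, le_div_iff₀ (by positivity)] at this
    nlinarith
  · have := h _ (div_pos hx hA')
    have e : x / A * A + B / (x / A) = x + A * B / x := by field_simp
    rw [e] at this
    have h2 : A * B / x < x := by rw [div_lt_iff₀ hx]; nlinarith
    linarith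

section Energy

variable {M : ℝ} {μ σ : Plane → ℝ} {γ : ℝ → Plane}

lemma Admissible.bound_nonneg (h : Admissible M μ σ) : 0 ≤ M := by
  have h0 : (0 : Plane) ∈ Quad := fun j => le_rfl
  exact (h.mu_nonneg _ h0).trans (h.mu_le _ h0)

lemma ell_nonneg (h : Admissible M μ σ) {x p : Plane} (hx : x ∈ Quad) (hp : ∀ j, 0 ≤ p j) :
    0 ≤ ell μ σ x p := by
  have := h.mu_nonneg x hx
  have := h.sigma_nonneg x hx
  have := hp 0
  have := hp 1
  unfold ell
  positivity

lemma ell_mono {x p : Plane} {m s : ℝ} (hp : ∀ j, 0 ≤ p j) (hm : μ x ≤ m) (hs : σ x ≤ s) :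
    ell μ σ x p ≤ m * (p 0 + p 1) + 2 * s * Real.sqrt (p 0 * p 1) := by
  have := hp 0
  have := hp 1
  unfold ell
  gcongr

lemma ell_smul {x p : Plane} {c : ℝ} (hc : 0 ≤ c) : ell μ σ x (c • p) = c * ell μ σ x p := by
  have e : (c • p) 0 * (c • p) 1 = c ^ 2 * (p 0 * p 1) := by
    simp only [PiLp.smul_apply, smul_eq_mul]; ring
  unfold ell
  rw [e, Real.sqrt_mul (sq_nonneg c), Real.sqrt_sq hc]
  simp only [PiLp.smul_apply, smul_eq_mul]
  ring

/-- An upper semicontinuous function on the quadrant is measurable along a curve. -/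
lemma aestronglyMeasurable_comp_curve {h : Plane → ℝ} (hh : UpperSemicontinuousOn h Quad)
    (hγ : γ ∈ MonotoneCurves) :
    MeasureTheory.AEStronglyMeasurable (fun t => h (γ t))
      (MeasureTheory.volume.restrict (Icc 0 1)) := by
  have h1 : UpperSemicontinuousOn (fun t => h (γ t)) (Icc 0 1) :=
    hh.comp hγ.1.continuousOn hγ.2.1
  have h2 : Measurable ((Icc (0 : ℝ) 1).domRestrict fun t => h (γ t)) :=
    (upperSemicontinuousOn_iff_restrict.2 h1).measurable
  exact (aemeasurable_restrict_of_measurable_subtype measurableSet_Icc h2).aestronglyMeasurable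

lemma curve_intervalIntegrable_ell (hγ : γ ∈ MonotoneCurves) (h : Admissible M μ σ)
    {a b : ℝ} (ha : 0 ≤ a) (hab : a ≤ b) (hb : b ≤ 1) :
    IntervalIntegrable (fun t => ell μ σ (γ t) (derivWithin γ (Icc 0 1) t))
      MeasureTheory.volume a b := by
  have hsub := Icc_subset_Icc ha hb
  rw [intervalIntegrable_iff_integrableOn_Icc_of_le hab]
  have c0 := curve_continuousOn_deriv_coord hγ 0
  have c1 := curve_continuousOn_deriv_coord hγ 1
  have cs : ContinuousOn (fun t => (derivWithin γ (Icc 0 1) t 0 + derivWithin γ (Icc 0 1) t 1))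
    (Icc 0 1) := c0.add c1
  have cq : ContinuousOn (fun t => Real.sqrt (derivWithin γ (Icc 0 1) t 0 *
    derivWithin γ (Icc 0 1) t 1)) (Icc 0 1) := (c0.mul c1).sqrt
  have hdom : MeasureTheory.IntegrableOn (fun t => M * (derivWithin γ (Icc 0 1) t 0 +
      derivWithin γ (Icc 0 1) t 1) + 2 * M * Real.sqrt (derivWithin γ (Icc 0 1) t 0 *
      derivWithin γ (Icc 0 1) t 1)) (Icc 0 1) :=
    ((continuousOn_const.mul cs).add (continuousOn_const.mul cq)).integrableOn_Icc
  refine MeasureTheory.IntegrableOn.mono_set ?_ hsub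
  refine MeasureTheory.Integrable.mono' hdom ?_ ?_
  · have := ((aestronglyMeasurable_comp_curve h.mu_usc hγ).mul
      (cs.aestronglyMeasurable measurableSet_Icc)).add
      (((aestronglyMeasurable_comp_curve h.sigma_usc hγ).const_mul 2).mul
      (cq.aestronglyMeasurable measurableSet_Icc))
    exact this
  · refine (MeasureTheory.ae_restrict_iff' measurableSet_Icc).2
      (Eventually.of_forall fun t ht => ?_)
    have hq := hγ.2.1 t ht
    rw [Real.norm_of_nonneg (ell_nonneg h hq (hγ.2.2 t ht))]
    exact ell_mono (hγ.2.2 t ht) (h.mu_le _ hq) (h.sigma_le _ hq)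

/-- Jensen's inequality for the energy of a piece of curve along which `μ ≤ m` and `σ ≤ s`. -/
lemma curve_integral_ell_le (hγ : γ ∈ MonotoneCurves) (h : Admissible M μ σ)
    {a b m s : ℝ} (ha : 0 ≤ a) (hab : a ≤ b) (hb : b ≤ 1)
    (hm : ∀ t ∈ Icc a b, μ (γ t) ≤ m) (hs : ∀ t ∈ Icc a b, σ (γ t) ≤ s) :
    ∫ t in a..b, ell μ σ (γ t) (derivWithin γ (Icc 0 1) t) ≤
      m * ((γ b 0 - γ a 0) + (γ b 1 - γ a 1)) +
        2 * s * Real.sqrt ((γ b 0 - γ a 0) * (γ b 1 - γ a 1)) := by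
  have hs0 : 0 ≤ s :=
    (h.sigma_nonneg _ (hγ.2.1 a ⟨ha, hab.trans hb⟩)).trans (hs a ⟨le_rfl, hab⟩)
  have i0 := curve_intervalIntegrable_deriv_coord hγ ha hab hb 0
  have i1 := curve_intervalIntegrable_deriv_coord hγ ha hab hb 1
  have e0 := curve_integral_deriv_coord hγ ha hab hb 0
  have e1 := curve_integral_deriv_coord hγ ha hab hb 1
  have key : ∀ l : ℝ, 0 < l → ∫ t in a..b, ell μ σ (γ t) (derivWithin γ (Icc 0 1) t) ≤
      m * ((γ b 0 - γ a 0) + (γ b 1 - γ a 1)) +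
        s * (l * (γ b 0 - γ a 0) + (γ b 1 - γ a 1) / l) := by
    intro l hl
    have hint : ∫ t in a..b, (m * (derivWithin γ (Icc 0 1) t 0 + derivWithin γ (Icc 0 1) t 1) +
        s * (l * derivWithin γ (Icc 0 1) t 0 + derivWithin γ (Icc 0 1) t 1 / l)) =
        m * ((γ b 0 - γ a 0) + (γ b 1 - γ a 1)) +
        s * (l * (γ b 0 - γ a 0) + (γ b 1 - γ a 1) / l) := by
      rw [intervalIntegral.integral_add ((i0.add i1).const_mul m)
        (((i0.const_mul l).add (i1.div_const l)).const_mul s),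
        intervalIntegral.integral_const_mul, intervalIntegral.integral_const_mul,
        intervalIntegral.integral_add i0 i1,
        intervalIntegral.integral_add (i0.const_mul l) (i1.div_const l),
        intervalIntegral.integral_const_mul, intervalIntegral.integral_div, e0, e1]
    rw [← hint]
    refine intervalIntegral.integral_mono_on hab (curve_intervalIntegrable_ell hγ h ha hab hb)
      (((i0.add i1).const_mul m).add (((i0.const_mul l).add (i1.div_const l)).const_mul s)) ?_
    intro t ht
    have hp := hγ.2.2 t ⟨ha.trans ht.1, ht.2.trans hb⟩
    refine (ell_mono hp (hm t ht) (hs t ht)).trans ?_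
    have h2 := two_mul_sqrt_mul_le_add (mul_nonneg hl.le (hp 0)) (div_nonneg (hp 1) hl.le)
    have e : l * derivWithin γ (Icc 0 1) t 0 * (derivWithin γ (Icc 0 1) t 1 / l) =
      derivWithin γ (Icc 0 1) t 0 * derivWithin γ (Icc 0 1) t 1 := by field_simp
    rw [e] at h2
    nlinarith
  have d0 := curve_coord_mono hγ ha hab hb 0
  have d1 := curve_coord_mono hγ ha hab hb 1
  rcases hs0.eq_or_lt with rfl | hs'
  · have := key 1 one_pos
    simpa using this
  · have hx : ∀ I X : ℝ, I ≤ m * ((γ b 0 - γ a 0) + (γ b 1 - γ a 1)) + s * X →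
        2 * ((I - m * ((γ b 0 - γ a 0) + (γ b 1 - γ a 1))) / (2 * s)) ≤ X := by
      intro I X h
      rw [mul_div_assoc', mul_div_mul_left _ _ two_ne_zero, div_le_iff₀ hs']
      linarith
    have := two_mul_le_two_mul_sqrt_mul (sub_nonneg.2 d0) (sub_nonneg.2 d1)
      fun l hl => hx _ _ (key l hl)
    rw [mul_div_assoc', mul_div_mul_left _ _ two_ne_zero, div_le_iff₀ hs'] at this
    linarith

end Energy

/-! ### The value function -/

section Value

variable {M : ℝ} {μ σ : Plane → ℝ} {x y z : Plane}

lemma above_subset_quad {x y : Plane} (hx : x ∈ Quad) (hxy : y ∈ Above x) : y ∈ Quad :=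
  fun j => (hx j).trans (hxy j)

lemma hasDerivAt_segment (x y : Plane) (t : ℝ) :
    HasDerivAt (fun t : ℝ => x + t • (y - x)) (y - x) t := by
  simpa using ((hasDerivAt_id t).smul_const (y - x)).const_add x

lemma derivWithin_segment (x y : Plane) {t : ℝ} (ht : t ∈ Icc (0 : ℝ) 1) :
    derivWithin (fun t : ℝ => x + t • (y - x)) (Icc 0 1) t = y - x :=
  (hasDerivAt_segment x y t).hasDerivWithinAt.derivWithin (uniqueDiffOn_Icc one_pos t ht)

lemma segment_mem_monotoneCurves (hx : x ∈ Quad) (hxy : y ∈ Above x) :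
    (fun t : ℝ => x + t • (y - x)) ∈ MonotoneCurves := by
  refine ⟨(contDiff_const.add (contDiff_id.smul contDiff_const)).contDiffOn, ?_, ?_⟩
  · intro t ht j
    have := hx j
    have := sub_nonneg.2 (hxy j)
    have := ht.1
    simp only [PiLp.add_apply, PiLp.smul_apply, PiLp.sub_apply, smul_eq_mul]
    positivity
  · intro t ht j
    rw [derivWithin_segment x y ht]
    exact sub_nonneg.2 (hxy j)

lemma bddAbove_energies (h : Admissible M μ σ) (x y : Plane) :
    BddAbove {r | ∃ γ ∈ MonotoneCurves, γ 0 = x ∧ γ 1 = y ∧ J μ σ γ = r} := by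
  refine ⟨M * ((y 0 - x 0) + (y 1 - x 1)) + 2 * M * Real.sqrt ((y 0 - x 0) * (y 1 - x 1)), ?_⟩
  rintro r ⟨γ, hγ, rfl, rfl, rfl⟩
  exact curve_integral_ell_le hγ h le_rfl zero_le_one le_rfl
    (fun t ht => h.mu_le _ (hγ.2.1 t ht)) (fun t ht => h.sigma_le _ (hγ.2.1 t ht))

lemma J_le_W (h : Admissible M μ σ) {γ : ℝ → Plane} (hγ : γ ∈ MonotoneCurves) (h0 : γ 0 = x)
    (h1 : γ 1 = y) : J μ σ γ ≤ W μ σ x y :=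
  le_csSup (bddAbove_energies h x y) ⟨γ, hγ, h0, h1, rfl⟩

lemma energies_nonempty (μ σ : Plane → ℝ) (hx : x ∈ Quad) (hxy : y ∈ Above x) :
    {r | ∃ γ ∈ MonotoneCurves, γ 0 = x ∧ γ 1 = y ∧ J μ σ γ = r}.Nonempty :=
  ⟨_, _, segment_mem_monotoneCurves hx hxy, by simp, by simp, rfl⟩

lemma W_le {c : ℝ} (hx : x ∈ Quad) (hxy : y ∈ Above x)
    (hc : ∀ γ ∈ MonotoneCurves, γ 0 = x → γ 1 = y → J μ σ γ ≤ c) : W μ σ x y ≤ c := by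
  refine csSup_le (energies_nonempty μ σ hx hxy) ?_
  rintro r ⟨γ, hγ, h0, h1, rfl⟩
  exact hc γ hγ h0 h1

/-- The energy of the straight segment bounds the value function from below. -/
lemma box_le_W (h : Admissible M μ σ) (hx : x ∈ Quad) (hxy : y ∈ Above x) {m s : ℝ}
    (hm : ∀ q : Plane, (∀ j, x j ≤ q j ∧ q j ≤ y j) → m ≤ μ q ∧ s ≤ σ q) :
    m * ((y 0 - x 0) + (y 1 - x 1)) + 2 * s * Real.sqrt ((y 0 - x 0) * (y 1 - x 1)) ≤
      W μ σ x y := by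
  have hγ := segment_mem_monotoneCurves hx hxy
  refine le_trans ?_ (J_le_W h hγ (by simp) (by simp))
  have hc : ∫ _t in (0 : ℝ)..1, (m * ((y 0 - x 0) + (y 1 - x 1)) +
      2 * s * Real.sqrt ((y 0 - x 0) * (y 1 - x 1))) =
      m * ((y 0 - x 0) + (y 1 - x 1)) +
      2 * s * Real.sqrt ((y 0 - x 0) * (y 1 - x 1)) := by simp
  rw [← hc]
  refine intervalIntegral.integral_mono_on zero_le_one intervalIntegrable_const
    (curve_intervalIntegrable_ell hγ h le_rfl zero_le_one le_rfl) ?_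
  intro t ht
  rw [derivWithin_segment x y ht]
  have hd : ∀ j, 0 ≤ y j - x j := fun j => sub_nonneg.2 (hxy j)
  obtain ⟨h1, h2⟩ := hm (x + t • (y - x)) fun j => by
    simp only [PiLp.add_apply, PiLp.smul_apply, PiLp.sub_apply, smul_eq_mul]
    constructor <;> nlinarith [hd j, ht.1, ht.2]
  have := hd 0
  have := hd 1
  unfold ell
  simp only [PiLp.sub_apply]
  gcongr

lemma W_nonneg (h : Admissible M μ σ) (hx : x ∈ Quad) (hxy : y ∈ Above x) : 0 ≤ W μ σ x y := by
  have := box_le_W h hx hxy (m := 0) (s := 0) fun q hq =>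
    ⟨h.mu_nonneg q fun j => (hx j).trans (hq j).1, h.sigma_nonneg q fun j => (hx j).trans (hq j).1⟩
  simpa using this

/-! ### Concatenation of curves -/

lemma deriv_smoothTransition_of_nonpos {t : ℝ} (ht : t ≤ 0) :
    deriv Real.smoothTransition t = 0 := by
  refine IsLocalMin.deriv_eq_zero (Eventually.of_forall fun u => ?_)
  rw [Real.smoothTransition.zero_of_nonpos ht]
  exact Real.smoothTransition.nonneg u

lemma deriv_smoothTransition_of_one_le {t : ℝ} (ht : 1 ≤ t) :
    deriv Real.smoothTransition t = 0 := by
  refine IsLocalMax.deriv_eq_zero (Eventually.of_forall fun u => ?_)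
  rw [Real.smoothTransition.one_of_one_le ht]
  exact Real.smoothTransition.le_one u

lemma hasDerivAt_smoothTransition_affine (c t : ℝ) :
    HasDerivAt (fun t => Real.smoothTransition (2 * t - c))
      (2 * deriv Real.smoothTransition (2 * t - c)) t := by
  have h1 : HasDerivAt Real.smoothTransition (deriv Real.smoothTransition (2 * t - c))
      (2 * t - c) :=
    ((Real.smoothTransition.contDiff (n := 1)).differentiable one_ne_zero _).hasDerivAt
  have h2 : HasDerivAt (fun t : ℝ => 2 * t - c) 2 t := by
    simpa using ((hasDerivAt_id t).const_mul 2).sub_const c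
  simpa [mul_comm] using! h1.comp t h2

lemma deriv_smoothTransition_nonneg (t : ℝ) : 0 ≤ deriv Real.smoothTransition t :=
  Real.smoothTransition.monotone.deriv_nonneg

lemma smoothTransition_mem_Icc (t : ℝ) : Real.smoothTransition t ∈ Icc (0 : ℝ) 1 :=
  ⟨Real.smoothTransition.nonneg t, Real.smoothTransition.le_one t⟩

lemma integral_comp_smoothTransition (F : ℝ → ℝ) (c : ℝ) :
    ∫ t in (c / 2)..((c + 1) / 2), 2 * deriv Real.smoothTransition (2 * t - c) *
      F (Real.smoothTransition (2 * t - c)) = ∫ u in (0 : ℝ)..1, F u := by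
  have hab : c / 2 ≤ (c + 1) / 2 := by linarith
  have := MeasureTheory.integral_Icc_deriv_smul_of_deriv_nonneg
    (f := fun t => Real.smoothTransition (2 * t - c))
    (f' := fun t => 2 * deriv Real.smoothTransition (2 * t - c))
    (a := c / 2) (b := (c + 1) / 2) (g := F)
    (fun t _ => (hasDerivAt_smoothTransition_affine c t).continuousAt.continuousWithinAt)
    (fun t _ => hasDerivAt_smoothTransition_affine c t)
    (fun t _ => mul_nonneg zero_le_two (deriv_smoothTransition_nonneg _)) hab
  have e1 : 2 * (c / 2) - c = 0 := by ring
  have e2 : 2 * ((c + 1) / 2) - c = 1 := by ring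
  rw [e1, e2, Real.smoothTransition.zero, Real.smoothTransition.one] at this
  rw [intervalIntegral.integral_of_le hab, intervalIntegral.integral_of_le zero_le_one,
    ← MeasureTheory.integral_Icc_eq_integral_Ioc, ← MeasureTheory.integral_Icc_eq_integral_Ioc,
    ← this]
  simp only [smul_eq_mul]

/-- The concatenation of two curves meeting at `y`, reparametrized so that the velocity vanishes at
the junction. -/
noncomputable def concat (γ₁ γ₂ : ℝ → Plane) (y : Plane) (t : ℝ) : Plane :=
  γ₁ (Real.smoothTransition (2 * t - 0)) + γ₂ (Real.smoothTransition (2 * t - 1)) - y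

lemma hasDerivAt_comp_smoothTransition {γ : ℝ → Plane} (hγ : γ ∈ MonotoneCurves) (c t : ℝ) :
    HasDerivAt (fun t => γ (Real.smoothTransition (2 * t - c)))
      ((2 * deriv Real.smoothTransition (2 * t - c)) •
        derivWithin γ (Icc 0 1) (Real.smoothTransition (2 * t - c))) t := by
  have h1 := (hγ.1.differentiableOn one_ne_zero _
    (smoothTransition_mem_Icc (2 * t - c))).hasDerivWithinAt
  have h2 := (hasDerivAt_smoothTransition_affine c t).hasDerivWithinAt (s := univ)
  exact (h1.scomp t h2 fun u _ => smoothTransition_mem_Icc _).hasDerivAt univ_mem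

lemma contDiff_comp_smoothTransition {γ : ℝ → Plane} (hγ : γ ∈ MonotoneCurves) (c : ℝ) :
    ContDiff ℝ 1 (fun t => γ (Real.smoothTransition (2 * t - c))) := by
  rw [← contDiffOn_univ]
  refine hγ.1.comp (t := Icc 0 1) ?_ fun u _ => smoothTransition_mem_Icc _
  exact (Real.smoothTransition.contDiff.comp
    ((contDiff_const.mul contDiff_id).sub contDiff_const)).contDiffOn

/-- The reversed triangle inequality for the value function. -/
lemma W_superadditive (h : Admissible M μ σ) (hx : x ∈ Quad) (hxy : y ∈ Above x)
    (hyz : z ∈ Above y) : W μ σ x y + W μ σ y z ≤ W μ σ x z := by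
  have hy := above_subset_quad hx hxy
  suffices H : ∀ γ₁ ∈ MonotoneCurves, γ₁ 0 = x → γ₁ 1 = y → ∀ γ₂ ∈ MonotoneCurves, γ₂ 0 = y →
      γ₂ 1 = z → J μ σ γ₁ + J μ σ γ₂ ≤ W μ σ x z by
    have h1 : W μ σ x y ≤ W μ σ x z - W μ σ y z := by
      refine W_le hx hxy fun γ₁ hγ₁ h0 h1 => ?_
      have : W μ σ y z ≤ W μ σ x z - J μ σ γ₁ :=
        W_le hy hyz fun γ₂ hγ₂ k0 k1 => by linarith [H γ₁ hγ₁ h0 h1 γ₂ hγ₂ k0 k1]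
      linarith
    linarith
  intro γ₁ hγ₁ h0 h1 γ₂ hγ₂ k0 k1
  have hd : ∀ t, HasDerivAt (concat γ₁ γ₂ y) ((2 * deriv Real.smoothTransition (2 * t - 0)) •
        derivWithin γ₁ (Icc 0 1) (Real.smoothTransition (2 * t - 0)) +
        (2 * deriv Real.smoothTransition (2 * t - 1)) •
        derivWithin γ₂ (Icc 0 1) (Real.smoothTransition (2 * t - 1))) t := fun t =>
    ((hasDerivAt_comp_smoothTransition hγ₁ 0 t).add
      (hasDerivAt_comp_smoothTransition hγ₂ 1 t)).sub_const y
  have hdw := fun t (ht : t ∈ Icc (0 : ℝ) 1) =>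
    (hd t).hasDerivWithinAt.derivWithin (uniqueDiffOn_Icc one_pos t ht)
  have left : ∀ t ∈ Icc (0 / 2 : ℝ) ((0 + 1) / 2),
      concat γ₁ γ₂ y t = γ₁ (Real.smoothTransition (2 * t - 0)) ∧
      derivWithin (concat γ₁ γ₂ y) (Icc 0 1) t =
        (2 * deriv Real.smoothTransition (2 * t - 0)) •
        derivWithin γ₁ (Icc 0 1) (Real.smoothTransition (2 * t - 0)) := by
    intro t ht
    have h2 : 2 * t - 1 ≤ 0 := by linarith [ht.2]
    constructor
    · rw [concat, Real.smoothTransition.zero_of_nonpos h2, k0, add_sub_cancel_right]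
    · rw [hdw t ⟨by linarith [ht.1], by linarith [ht.2]⟩, deriv_smoothTransition_of_nonpos h2]
      simp
  have right : ∀ t ∈ Icc (1 / 2 : ℝ) ((1 + 1) / 2),
      concat γ₁ γ₂ y t = γ₂ (Real.smoothTransition (2 * t - 1)) ∧
      derivWithin (concat γ₁ γ₂ y) (Icc 0 1) t =
        (2 * deriv Real.smoothTransition (2 * t - 1)) •
        derivWithin γ₂ (Icc 0 1) (Real.smoothTransition (2 * t - 1)) := by
    intro t ht
    have h2 : 1 ≤ 2 * t - 0 := by linarith [ht.1]
    constructor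
    · rw [concat, Real.smoothTransition.one_of_one_le h2, h1, add_sub_cancel_left]
    · rw [hdw t ⟨by linarith [ht.1], by linarith [ht.2]⟩, deriv_smoothTransition_of_one_le h2]
      simp
  have hmem : concat γ₁ γ₂ y ∈ MonotoneCurves := by
    refine ⟨((contDiff_comp_smoothTransition hγ₁ 0).add
      (contDiff_comp_smoothTransition hγ₂ 1)).sub contDiff_const |>.contDiffOn, ?_, ?_⟩
    · intro t ht
      rcases le_total t (1 / 2) with ht' | ht'
      · rw [(left t ⟨by linarith [ht.1], by linarith⟩).1]
        exact hγ₁.2.1 _ (smoothTransition_mem_Icc _)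
      · rw [(right t ⟨by linarith, by linarith [ht.2]⟩).1]
        exact hγ₂.2.1 _ (smoothTransition_mem_Icc _)
    · intro t ht j
      rw [hdw t ht]
      exact add_nonneg
        (mul_nonneg (mul_nonneg zero_le_two (deriv_smoothTransition_nonneg _))
          (hγ₁.2.2 _ (smoothTransition_mem_Icc _) j))
        (mul_nonneg (mul_nonneg zero_le_two (deriv_smoothTransition_nonneg _))
          (hγ₂.2.2 _ (smoothTransition_mem_Icc _) j))
  have c0 : concat γ₁ γ₂ y 0 = x := by
    rw [(left 0 ⟨by norm_num, by norm_num⟩).1]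
    simp [h0]
  have c1 : concat γ₁ γ₂ y 1 = z := by
    rw [(right 1 ⟨by norm_num, by norm_num⟩).1]
    norm_num [k1]
  refine le_trans (le_of_eq ?_) (J_le_W h hmem c0 c1)
  have i0 := curve_intervalIntegrable_ell hmem h (a := 0) (b := 1 / 2) le_rfl (by norm_num)
    (by norm_num)
  have i1 := curve_intervalIntegrable_ell hmem h (a := 1 / 2) (b := 1) (by norm_num) (by norm_num)
    le_rfl
  have e1 := integral_comp_smoothTransition
    (fun u => ell μ σ (γ₁ u) (derivWithin γ₁ (Icc 0 1) u)) 0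
  have e2 := integral_comp_smoothTransition
    (fun u => ell μ σ (γ₂ u) (derivWithin γ₂ (Icc 0 1) u)) 1
  have g1 : ∀ (c t : ℝ), 0 ≤ 2 * deriv Real.smoothTransition (2 * t - c) := fun c t =>
    mul_nonneg zero_le_two (deriv_smoothTransition_nonneg _)
  rw [J, J, J, ← intervalIntegral.integral_add_adjacent_intervals i0 i1, ← e1, ← e2]
  congr 1
  · rw [zero_div, zero_add]
    refine intervalIntegral.integral_congr fun t ht => ?_
    rw [uIcc_of_le (by norm_num)] at ht
    obtain ⟨l1, l2⟩ := left t (by simpa using ht)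
    simp only [l1, l2, ell_smul (g1 0 t)]
  · rw [show ((1 : ℝ) + 1) / 2 = 1 by norm_num]
    refine intervalIntegral.integral_congr fun t ht => ?_
    rw [uIcc_of_le (by norm_num)] at ht
    obtain ⟨l1, l2⟩ := right t ⟨ht.1, by linarith [ht.2]⟩
    simp only [l1, l2, ell_smul (g1 1 t)]

end Value

/-! ### Bisection along a curve -/

/-- A relation between the parameters of a curve that holds on pieces of `Φ`-length at most `δ` and
passes from two adjacent pieces to their union (with the counter `n` raised by one) holds on pieces
of `Φ`-length at most `2 ^ n * δ`. -/
lemma bisection {a b δ : ℝ} {Φ : ℝ → ℝ} (hΦ : ContinuousOn Φ (Icc a b))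
    {R : ℕ → ℝ → ℝ → Prop}
    (base : ∀ c e, a ≤ c → c ≤ e → e ≤ b → Φ e - Φ c ≤ δ → R 0 c e)
    (step : ∀ n c m e, a ≤ c → c ≤ m → m ≤ e → e ≤ b → R n c m → R n m e → R (n + 1) c e)
    (hm : ∀ c e, a ≤ c → c ≤ e → e ≤ b → Φ c ≤ Φ e) (n : ℕ) :
    ∀ c e, a ≤ c → c ≤ e → e ≤ b → Φ e - Φ c ≤ 2 ^ n * δ → R n c e := by
  induction n with
  | zero =>
    intro c e hac hce heb h
    exact base c e hac hce heb (by simpa using h)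
  | succ n ih =>
    intro c e hac hce heb h
    have hle := hm c e hac hce heb
    obtain ⟨m, hmm, hmid⟩ := intermediate_value_Icc hce (hΦ.mono (Icc_subset_Icc hac heb))
      (show (Φ c + Φ e) / 2 ∈ Icc (Φ c) (Φ e) from ⟨by linarith, by linarith⟩)
    rw [pow_succ] at h
    exact step n c m e hac hmm.1 hmm.2 heb (ih c m hac hmm.1 (hmm.2.trans heb) (by linarith))
      (ih m e (hac.trans hmm.1) hmm.2 heb (by linarith))

/-! ### Comparison of two costs on a small box by shifting the curve -/

/-- The cost `(μ', σ')` dominates `(μ, σ)` on `S` up to `ε` after a displacement of size about `s`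
in the quadrant of directions with signs `d`. -/
def Dominates (s ε : ℝ) (d : Fin 2 → ℝ) (S : Set Plane) (μ σ μ' σ' : Plane → ℝ) : Prop :=
  ∀ w ∈ S, ∀ q ∈ S, (∀ j, 0 ≤ d j * (q j - w j) ∧ d j * (q j - w j) ≤ 3 * s) →
    (∃ j, s ≤ d j * (q j - w j)) → μ w ≤ μ' q + ε ∧ σ w ≤ σ' q + ε

open Classical in
/-- The number `p ∈ [P, Q]` shifted by `2 * s` in the direction of the sign `d`, and then clamped
to `[P, Q]`. -/
noncomputable def shiftClamp (s d P Q p : ℝ) : ℝ :=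
  if d = 1 then min (p + 2 * s) Q else max (p - 2 * s) P

section shiftClamp

variable {s d P Q p p' w q : ℝ}

lemma shiftClamp_mem (hs : 0 ≤ s) (h1 : P ≤ p) (h2 : p ≤ Q) :
    P ≤ shiftClamp s d P Q p ∧ shiftClamp s d P Q p ≤ Q := by
  unfold shiftClamp
  split_ifs
  · exact ⟨le_min (by linarith) (by linarith), min_le_right _ _⟩
  · exact ⟨le_max_right _ _, max_le (by linarith) (by linarith)⟩

lemma shiftClamp_mono (h : p ≤ p') : shiftClamp s d P Q p ≤ shiftClamp s d P Q p' := by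
  unfold shiftClamp
  split_ifs <;> gcongr

lemma shiftClamp_sub_le (h : p ≤ p') :
    shiftClamp s d P Q p' - shiftClamp s d P Q p ≤ p' - p := by
  unfold shiftClamp
  split_ifs
  · rcases min_cases (p' + 2 * s) Q with h1 | h1 <;> rcases min_cases (p + 2 * s) Q with h2 | h2 <;>
      linarith
  · rcases max_cases (p' - 2 * s) P with h1 | h1 <;> rcases max_cases (p - 2 * s) P with h2 | h2 <;>
      linarith

lemma shiftClamp_displacement (hs : 0 ≤ s) (hPQ : P ≤ Q) :
    (Q - shiftClamp s d P Q Q) - (P - shiftClamp s d P Q P) ≤ 2 * s := by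
  unfold shiftClamp
  split_ifs
  · rcases min_cases (Q + 2 * s) Q with h1 | h1 <;> rcases min_cases (P + 2 * s) Q with h2 | h2 <;>
      linarith
  · rcases max_cases (Q - 2 * s) P with h1 | h1 <;> rcases max_cases (P - 2 * s) P with h2 | h2 <;>
      linarith

lemma shiftClamp_displaced (hs : 0 ≤ s) (hd : d = 1 ∨ d = -1) (h1 : P ≤ p) (h2 : p' ≤ Q)
    (hpp : p' ≤ p + s) (hw : p ≤ w ∧ w ≤ p')
    (hq : shiftClamp s d P Q p ≤ q ∧ q ≤ shiftClamp s d P Q p') :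
    (0 ≤ d * (q - w) ∧ d * (q - w) ≤ 3 * s) ∧
      (shiftClamp s d P Q p < shiftClamp s d P Q p' → s ≤ d * (q - w)) := by
  have h11 : (-1 : ℝ) ≠ 1 := by norm_num
  rcases hd with rfl | rfl
  · simp only [shiftClamp, if_true] at hq ⊢
    rcases min_cases (p + 2 * s) Q with h3 | h3 <;>
      rcases min_cases (p' + 2 * s) Q with h4 | h4 <;>
      refine ⟨⟨?_, ?_⟩, fun h => ?_⟩ <;> linarith [hq.1, hq.2, hw.1, hw.2]
  · simp only [shiftClamp, if_neg h11] at hq ⊢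
    rcases max_cases (p - 2 * s) P with h3 | h3 <;>
      rcases max_cases (p' - 2 * s) P with h4 | h4 <;>
      refine ⟨⟨?_, ?_⟩, fun h => ?_⟩ <;> linarith [hq.1, hq.2, hw.1, hw.2]

end shiftClamp

/-- The geometric mean loses little when its arguments are decreased a little, in a form that is
additive in the four arguments. -/
lemma sqrt_mul_sub_sqrt_mul_le {x y x' y' η : ℝ} (hη : 0 < η) (hx' : 0 ≤ x') (hy' : 0 ≤ y')
    (hx : x' ≤ x) (hy : y' ≤ y) :
    2 * Real.sqrt (x * y) ≤
      2 * Real.sqrt (x' * y') + (η * (x + y) + ((x - x') + (y - y')) / η) := by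
  have e : x * y = x' * y' + ((x - x') * y + x' * (y - y')) := by ring
  have hx0 : 0 ≤ x := hx'.trans hx
  have hy0 : 0 ≤ y := hy'.trans hy
  have hsub : ∀ u v : ℝ, 0 ≤ u → 0 ≤ v → √(u + v) ≤ √u + √v := fun u v hu hv => by
    rw [Real.sqrt_le_left (by positivity)]
    nlinarith [Real.sq_sqrt hu, Real.sq_sqrt hv, Real.sqrt_nonneg u, Real.sqrt_nonneg v]
  have p1 : 0 ≤ (x - x') * y := mul_nonneg (sub_nonneg.2 hx) hy0
  have p2 : 0 ≤ x' * (y - y') := mul_nonneg hx' (sub_nonneg.2 hy)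
  have h1 : √(x * y) ≤ √(x' * y') + (√((x - x') * y) + √(x' * (y - y'))) := by
    rw [e]
    exact (hsub _ _ (mul_nonneg hx' hy') (add_nonneg p1 p2)).trans
      (add_le_add_right (hsub _ _ p1 p2) _)
  have h2 := two_mul_sqrt_mul_le_add (div_nonneg (sub_nonneg.2 hx) hη.le) (mul_nonneg hη.le hy0)
  have h3 := two_mul_sqrt_mul_le_add (mul_nonneg hη.le hx') (div_nonneg (sub_nonneg.2 hy) hη.le)
  have e2 : (x - x') / η * (η * y) = (x - x') * y := by field_simp
  have e3 : η * x' * ((y - y') / η) = x' * (y - y') := by field_simp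
  rw [e2] at h2
  rw [e3] at h3
  have h4 : η * x' ≤ η * x := by gcongr
  rw [add_div]
  linarith

section Local

variable {M : ℝ} {μ σ μ' σ' : Plane → ℝ}

/-- A curve confined to a box on which `(μ', σ')` dominates `(μ, σ)` after a displacement has no
more `(μ, σ)`-energy than the `(μ', σ')`-value of its endpoints, up to a small error. The competitor
is a chain of segments along the shifted curve, clamped to the box of the endpoints. -/
lemma integral_ell_le_W_of_dominates (h : Admissible M μ σ) (h' : Admissible M μ' σ')
    {s ε η : ℝ} {d : Fin 2 → ℝ} {S : Set Plane} (hs : 0 < s) (hε : 0 ≤ ε) (hη : 0 < η)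
    (hd : ∀ j, d j = 1 ∨ d j = -1) (hdom : Dominates s ε d S μ σ μ' σ')
    {γ : ℝ → Plane} (hγ : γ ∈ MonotoneCurves) {a b : ℝ} (ha : 0 ≤ a) (hab : a ≤ b) (hb : b ≤ 1)
    (hS : ∀ q : Plane, (∀ j, γ a j ≤ q j ∧ q j ≤ γ b j) → q ∈ S) :
    ∫ t in a..b, ell μ σ (γ t) (derivWithin γ (Icc 0 1) t) ≤ W μ' σ' (γ a) (γ b) +
      ((2 * ε + M * η) * ((γ b 0 - γ a 0) + (γ b 1 - γ a 1)) + M * (1 + 1 / η) * (4 * s)) := by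
  have hM := h.bound_nonneg
  have hmem : ∀ t, a ≤ t → t ≤ b → ∀ j, γ a j ≤ γ t j ∧ γ t j ≤ γ b j := fun t h1 h2 j =>
    ⟨curve_coord_mono hγ ha h1 (h2.trans hb) j, curve_coord_mono hγ (ha.trans h1) h2 hb j⟩
  have haQ := hγ.2.1 a ⟨ha, hab.trans hb⟩
  set τ : Fin 2 → ℝ → ℝ := fun j t => shiftClamp s (d j) (γ a j) (γ b j) (γ t j) with hτ
  set T : ℝ → Plane := fun t => !₂[τ 0 t, τ 1 t] with hT
  have hTj : ∀ t j, T t j = τ j t := by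
    intro t j
    fin_cases j <;> rfl
  have hτmem : ∀ t, a ≤ t → t ≤ b → ∀ j, γ a j ≤ τ j t ∧ τ j t ≤ γ b j := fun t h1 h2 j =>
    shiftClamp_mem hs.le (hmem t h1 h2 j).1 (hmem t h1 h2 j).2
  have hτmono : ∀ c e, a ≤ c → c ≤ e → e ≤ b → ∀ j, τ j c ≤ τ j e := fun c e h1 h2 h3 j =>
    shiftClamp_mono (curve_coord_mono hγ (ha.trans h1) h2 (h3.trans hb) j)
  have hTQ : ∀ t, a ≤ t → t ≤ b → T t ∈ Quad := fun t h1 h2 j => by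
    rw [hTj]
    exact (haQ j).trans (hτmem t h1 h2 j).1
  have hTA : ∀ c e, a ≤ c → c ≤ e → e ≤ b → T e ∈ Above (T c) := fun c e h1 h2 h3 j => by
    rw [hTj, hTj]
    exact hτmono c e h1 h2 h3 j
  set Φ : ℝ → ℝ := fun t => γ t 0 + γ t 1 with hΦ
  have hΦc : ContinuousOn Φ (Icc a b) :=
    ((curve_continuousOn_coord hγ 0).add (curve_continuousOn_coord hγ 1)).mono
      (Icc_subset_Icc ha hb)
  set A := 2 * ε + M * η with hA
  set B := M * (1 + 1 / η) with hB
  have hA0 : 0 ≤ A := by positivity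
  have hB0 : 0 ≤ B := by positivity
  -- The error is additive in the pieces: the `Φ`-length, and the increment of the displacement.
  let R : ℕ → ℝ → ℝ → Prop := fun _ c e =>
    ∫ t in c..e, ell μ σ (γ t) (derivWithin γ (Icc 0 1) t) ≤ W μ' σ' (T c) (T e) +
      (A * (Φ e - Φ c) +
        B * ((Φ e - (τ 0 e + τ 1 e)) - (Φ c - (τ 0 c + τ 1 c))))
  have base : ∀ c e, a ≤ c → c ≤ e → e ≤ b → Φ e - Φ c ≤ s → R 0 c e := by
    intro c e hac hce heb hstep
    have hc0 := ha.trans hac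
    have he1 := heb.trans hb
    have m0 := curve_coord_mono hγ hc0 hce he1 0
    have m1 := curve_coord_mono hγ hc0 hce he1 1
    have t0 := hτmono c e hac hce heb 0
    have t1 := hτmono c e hac hce heb 1
    have l0 : τ 0 e - τ 0 c ≤ γ e 0 - γ c 0 := shiftClamp_sub_le m0
    have l1 : τ 1 e - τ 1 c ≤ γ e 1 - γ c 1 := shiftClamp_sub_le m1
    have hstep' : (γ e 0 - γ c 0) + (γ e 1 - γ c 1) ≤ s := by
      simp only [hΦ] at hstep
      linarith
    have hsq := sqrt_mul_sub_sqrt_mul_le hη (sub_nonneg.2 t0) (sub_nonneg.2 t1) l0 l1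
    have hquad : ∀ t ∈ Icc c e, γ t ∈ Quad := fun t ht =>
      hγ.2.1 t ⟨hc0.trans ht.1, ht.2.trans he1⟩
    have hne : (Icc c e).Nonempty := ⟨c, le_rfl, hce⟩
    have hbm : BddAbove ((fun t => μ (γ t)) '' Icc c e) := by
      refine ⟨M, ?_⟩
      rintro _ ⟨t, ht, rfl⟩
      exact h.mu_le _ (hquad t ht)
    have hbs : BddAbove ((fun t => σ (γ t)) '' Icc c e) := by
      refine ⟨M, ?_⟩
      rintro _ ⟨t, ht, rfl⟩
      exact h.sigma_le _ (hquad t ht)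
    set m := sSup ((fun t => μ (γ t)) '' Icc c e) with hmdef
    set r := sSup ((fun t => σ (γ t)) '' Icc c e) with hrdef
    have hup := curve_integral_ell_le hγ h hc0 hce he1
      (m := m) (s := r) (fun t ht => le_csSup hbm ⟨t, ht, rfl⟩)
      (fun t ht => le_csSup hbs ⟨t, ht, rfl⟩)
    have hmM : m ≤ M := csSup_le (hne.image _) (by
      rintro _ ⟨t, ht, rfl⟩
      exact h.mu_le _ (hquad t ht))
    have hrM : r ≤ M := csSup_le (hne.image _) (by
      rintro _ ⟨t, ht, rfl⟩
      exact h.sigma_le _ (hquad t ht))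
    have hr0 : 0 ≤ r := (h.sigma_nonneg _ (hquad c ⟨le_rfl, hce⟩)).trans
      (le_csSup hbs ⟨c, ⟨le_rfl, hce⟩, rfl⟩)
    -- A lower bound for the value function that covers the case of a fully clamped piece.
    have hW : (m - ε) * ((τ 0 e - τ 0 c) + (τ 1 e - τ 1 c)) +
        2 * (r - ε) * √((τ 0 e - τ 0 c) * (τ 1 e - τ 1 c)) ≤ W μ' σ' (T c) (T e) := by
      by_cases hmove : ∃ j, τ j c < τ j e
      · obtain ⟨j₀, hj₀⟩ := hmove
        have := box_le_W h' (hTQ c hac (hce.trans heb)) (hTA c e hac hce heb) (m := m - ε)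
          (s := r - ε) fun q hq => ?_
        · simpa only [hTj] using this
        · have hqS : q ∈ S := hS q fun j => by
            have := hq j
            rw [hTj, hTj] at this
            exact ⟨(hτmem c hac (hce.trans heb) j).1.trans this.1,
              this.2.trans (hτmem e (hac.trans hce) heb j).2⟩
          have hdisp : ∀ t ∈ Icc c e, ∀ j, (0 ≤ d j * (q j - γ t j) ∧
              d j * (q j - γ t j) ≤ 3 * s) ∧ (τ j c < τ j e → s ≤ d j * (q j - γ t j)) := by
            intro t ht j
            have := hq j
            rw [hTj, hTj] at this
            refine shiftClamp_displaced hs.le (hd j) (hmem c hac (hce.trans heb) j).1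
              (hmem e (hac.trans hce) heb j).2 ?_
              ⟨curve_coord_mono hγ hc0 ht.1 (ht.2.trans he1) j,
                curve_coord_mono hγ (hc0.trans ht.1) ht.2 he1 j⟩ this
            fin_cases j
            · simp only [Fin.zero_eta]; linarith
            · simp only [Fin.mk_one]; linarith
          have hcomp : ∀ t ∈ Icc c e, μ (γ t) ≤ μ' q + ε ∧ σ (γ t) ≤ σ' q + ε := fun t ht =>
            hdom _ (hS _ (hmem t (hac.trans ht.1) (ht.2.trans heb))) q hqS
              (fun j => (hdisp t ht j).1) ⟨j₀, (hdisp t ht j₀).2 hj₀⟩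
          constructor
          · rw [sub_le_iff_le_add]
            refine csSup_le (hne.image _) ?_
            rintro _ ⟨t, ht, rfl⟩
            exact (hcomp t ht).1
          · rw [sub_le_iff_le_add]
            refine csSup_le (hne.image _) ?_
            rintro _ ⟨t, ht, rfl⟩
            exact (hcomp t ht).2
      · push Not at hmove
        have z0 : τ 0 e - τ 0 c = 0 := by linarith [hmove 0]
        have z1 : τ 1 e - τ 1 c = 0 := by linarith [hmove 1]
        rw [z0, z1]
        simpa using W_nonneg h' (hTQ c hac (hce.trans heb)) (hTA c e hac hce heb)
    have hsqb := two_mul_sqrt_mul_le_add (sub_nonneg.2 t0) (sub_nonneg.2 t1)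
    have hpos : 0 ≤ η * ((γ e 0 - γ c 0) + (γ e 1 - γ c 1)) +
        ((γ e 0 - γ c 0 - (τ 0 e - τ 0 c)) + (γ e 1 - γ c 1 - (τ 1 e - τ 1 c))) / η := by
      have : 0 ≤ (γ e 0 - γ c 0 - (τ 0 e - τ 0 c)) + (γ e 1 - γ c 1 - (τ 1 e - τ 1 c)) := by
        linarith
      have : 0 ≤ (γ e 0 - γ c 0) + (γ e 1 - γ c 1) := by linarith
      positivity
    have b1 := mul_le_mul_of_nonneg_left hsq hr0
    have b2 := mul_le_mul_of_nonneg_right hrM hpos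
    have b3 := mul_le_mul_of_nonneg_right hmM
      (show 0 ≤ (γ e 0 - γ c 0 - (τ 0 e - τ 0 c)) + (γ e 1 - γ c 1 - (τ 1 e - τ 1 c)) by linarith)
    have b4 := mul_le_mul_of_nonneg_left
      (hsqb.trans (show _ ≤ (γ e 0 - γ c 0) + (γ e 1 - γ c 1) by linarith)) hε
    have b5 := mul_le_mul_of_nonneg_left
      (show (τ 0 e - τ 0 c) + (τ 1 e - τ 1 c) ≤ (γ e 0 - γ c 0) + (γ e 1 - γ c 1) by linarith) hε
    have eB : B * ((Φ e - (τ 0 e + τ 1 e)) - (Φ c - (τ 0 c + τ 1 c))) =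
        M * ((γ e 0 - γ c 0 - (τ 0 e - τ 0 c)) + (γ e 1 - γ c 1 - (τ 1 e - τ 1 c))) +
        M * (((γ e 0 - γ c 0 - (τ 0 e - τ 0 c)) + (γ e 1 - γ c 1 - (τ 1 e - τ 1 c))) / η) := by
      simp only [hB, hΦ]
      ring
    have eA : A * (Φ e - Φ c) = 2 * (ε * ((γ e 0 - γ c 0) + (γ e 1 - γ c 1))) +
        M * (η * ((γ e 0 - γ c 0) + (γ e 1 - γ c 1))) := by
      simp only [hA, hΦ]
      ring
    change _ ≤ _ + (_ + _)
    rw [eA, eB]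
    generalize (γ e 0 - γ c 0 - (τ 0 e - τ 0 c) + (γ e 1 - γ c 1 - (τ 1 e - τ 1 c))) / η = X at *
    generalize √((τ 0 e - τ 0 c) * (τ 1 e - τ 1 c)) = Y at *
    generalize √((γ e 0 - γ c 0) * (γ e 1 - γ c 1)) = Z at *
    generalize W μ' σ' (T c) (T e) = V at *
    linarith
  have step : ∀ n c m e, a ≤ c → c ≤ m → m ≤ e → e ≤ b → R n c m → R n m e → R (n + 1) c e := by
    intro n c m e hac hcm hme heb h1 h2
    have hadd := intervalIntegral.integral_add_adjacent_intervals
      (curve_intervalIntegrable_ell hγ h (ha.trans hac) hcm (hme.trans (heb.trans hb)))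
      (curve_intervalIntegrable_ell hγ h (ha.trans (hac.trans hcm)) hme (heb.trans hb))
    have hsup := W_superadditive h' (hTQ c hac (hcm.trans (hme.trans heb)))
      (hTA c m hac hcm (hme.trans heb)) (hTA m e (hac.trans hcm) hme heb)
    simp only [R] at h1 h2 ⊢
    rw [← hadd]
    linarith
  obtain ⟨n, hn⟩ := pow_unbounded_of_one_lt ((Φ b - Φ a) / s) one_lt_two
  rw [div_lt_iff₀ hs] at hn
  have hfin := bisection hΦc base step (fun c e h1 h2 h3 => add_le_add
    (curve_coord_mono hγ (ha.trans h1) h2 (h3.trans hb) 0)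
    (curve_coord_mono hγ (ha.trans h1) h2 (h3.trans hb) 1)) n a b le_rfl hab le_rfl hn.le
  have s0 := shiftClamp_displacement (d := d 0) hs.le (hmem b hab le_rfl 0).1
  have s1 := shiftClamp_displacement (d := d 1) hs.le (hmem b hab le_rfl 1).1
  have hbQ := hγ.2.1 b ⟨ha.trans hab, hb⟩
  have w1 := W_superadditive h' haQ (y := T a) (z := T b)
    (fun j => by rw [hTj]; exact (hτmem a le_rfl hab j).1) (hTA a b le_rfl hab le_rfl)
  have w2 := W_superadditive h' haQ (y := T b) (z := γ b)
    (fun j => by rw [hTj]; exact (hτmem b hab le_rfl j).1)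
    (fun j => by rw [hTj]; exact (hτmem b hab le_rfl j).2)
  have w3 := W_nonneg h' haQ (y := T a)
    (fun j => by rw [hTj]; exact (hτmem a le_rfl hab j).1)
  have w4 := W_nonneg h' (hTQ b hab le_rfl) (y := γ b)
    (fun j => by rw [hTj]; exact (hτmem b hab le_rfl j).2)
  simp only [R] at hfin
  have e1 : Φ b - Φ a = (γ b 0 - γ a 0) + (γ b 1 - γ a 1) := by
    simp only [hΦ]
    ring
  rw [e1] at hfin
  have e2 : B * ((Φ b - (τ 0 b + τ 1 b)) - (Φ a - (τ 0 a + τ 1 a))) ≤ B * (4 * s) := by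
    refine mul_le_mul_of_nonneg_left ?_ hB0
    simp only [hΦ, hτ]
    linarith
  linarith

/-! ### Comparison of two costs away from finitely many antidiagonals -/

/-- The coordinate sum, which measures length along monotone curves. -/
def level (x : Plane) : ℝ := x 0 + x 1

/-- A local comparison of `(μ, σ)`-energies with `(μ', σ')`-values away from finitely many levels
yields a global one: the levels that are left out carry little energy. -/
lemma J_le_W_of_local (h : Admissible M μ σ) (h' : Admissible M μ' σ') {B : Finset ℝ}
    {ρ δ ε T : ℝ} (hδρ : δ ≤ ρ) (hρ : 0 < ρ) (hε : 0 ≤ ε)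
    (hloc : ∀ γ ∈ MonotoneCurves, ∀ a b, 0 ≤ a → a ≤ b → b ≤ 1 → level (γ b) - level (γ a) ≤ δ →
      level (γ a) ≤ T → (∀ β ∈ B, ρ ≤ |level (γ a) - β|) →
      ∫ t in a..b, ell μ σ (γ t) (derivWithin γ (Icc 0 1) t) ≤ W μ' σ' (γ a) (γ b) + ε)
    {n : ℕ} (hn : T ≤ 2 ^ n * δ) {γ : ℝ → Plane} (hγ : γ ∈ MonotoneCurves)
    (hT : level (γ 1) ≤ T) :
    J μ σ γ ≤ W μ' σ' (γ 0) (γ 1) + (2 ^ n * ε + 2 * M * (B.card * (4 * ρ))) := by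
  have hM := h.bound_nonneg
  have hmono : ∀ c e, 0 ≤ c → c ≤ e → e ≤ 1 → level (γ c) ≤ level (γ e) := fun c e h1 h2 h3 =>
    add_le_add (curve_coord_mono hγ h1 h2 h3 0) (curve_coord_mono hγ h1 h2 h3 1)
  -- Each omitted level `β` contributes through the clamp of the level function to `β ± 2ρ`.
  set ψ : ℝ → ℝ → ℝ := fun β u => max (β - 2 * ρ) (min u (β + 2 * ρ)) with hψ
  have hψm : ∀ β u v, u ≤ v → ψ β u ≤ ψ β v := fun β u v huv => by
    simp only [hψ]
    gcongr
  set Ψ : ℝ → ℝ := fun u => ∑ β ∈ B, ψ β u with hΨ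
  have hΨm : ∀ u v, u ≤ v → Ψ u ≤ Ψ v := fun u v huv => Finset.sum_le_sum fun β _ => hψm β u v huv
  let R : ℕ → ℝ → ℝ → Prop := fun k c e =>
    ∫ t in c..e, ell μ σ (γ t) (derivWithin γ (Icc 0 1) t) ≤ W μ' σ' (γ c) (γ e) +
      (2 ^ k * ε + 2 * M * (Ψ (level (γ e)) - Ψ (level (γ c))))
  have hA : ∀ c e, 0 ≤ c → c ≤ e → e ≤ 1 → γ e ∈ Above (γ c) := fun c e h1 h2 h3 j =>
    curve_coord_mono hγ h1 h2 h3 j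
  have base : ∀ c e, 0 ≤ c → c ≤ e → e ≤ 1 → level (γ e) - level (γ c) ≤ δ → R 0 c e := by
    intro c e h0 hce h1 hle
    have hm := hmono c e h0 hce h1
    have hΨce := hΨm _ _ hm
    by_cases hgood : ∀ β ∈ B, ρ ≤ |level (γ c) - β|
    · have := hloc γ hγ c e h0 hce h1 hle ((hmono c 1 h0 (hce.trans h1) le_rfl).trans hT) hgood
      have : 0 ≤ 2 * M * (Ψ (level (γ e)) - Ψ (level (γ c))) :=
        mul_nonneg (by positivity) (sub_nonneg.2 hΨce)
      simp only [R, pow_zero]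
      linarith
    · push Not at hgood
      obtain ⟨β, hβ, hlt⟩ := hgood
      rw [abs_lt] at hlt
      have hψe : ∀ u, β - ρ ≤ u → u ≤ β + 2 * ρ → ψ β u = u := fun u hu1 hu2 => by
        simp only [hψ]
        rw [min_eq_left hu2, max_eq_right (by linarith)]
      have hone : ψ β (level (γ e)) - ψ β (level (γ c)) ≤ Ψ (level (γ e)) - Ψ (level (γ c)) := by
        simp only [hΨ]
        rw [← Finset.sum_sub_distrib]
        exact Finset.single_le_sum (f := fun β => ψ β (level (γ e)) - ψ β (level (γ c)))
          (fun β _ => sub_nonneg.2 (hψm β _ _ hm)) hβ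
      rw [hψe _ (by linarith) (by linarith), hψe _ (by linarith) (by linarith)] at hone
      have hint := curve_integral_ell_le hγ h h0 hce h1
        (fun t ht => h.mu_le _ (hγ.2.1 t ⟨h0.trans ht.1, ht.2.trans h1⟩))
        (fun t ht => h.sigma_le _ (hγ.2.1 t ⟨h0.trans ht.1, ht.2.trans h1⟩))
      have hsq := two_mul_sqrt_mul_le_add (sub_nonneg.2 (hA c e h0 hce h1 0))
        (sub_nonneg.2 (hA c e h0 hce h1 1))
      have hW := W_nonneg h' (hγ.2.1 c ⟨h0, hce.trans h1⟩) (hA c e h0 hce h1)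
      have k1 := mul_le_mul_of_nonneg_left hsq hM
      have k2 := mul_le_mul_of_nonneg_left hone (show 0 ≤ 2 * M by positivity)
      simp only [R, pow_zero]
      simp only [level] at k2 ⊢
      linarith
  have step : ∀ k c m e, 0 ≤ c → c ≤ m → m ≤ e → e ≤ 1 → R k c m → R k m e → R (k + 1) c e := by
    intro k c m e hc hcm hme he h1 h2
    have hadd := intervalIntegral.integral_add_adjacent_intervals
      (curve_intervalIntegrable_ell hγ h hc hcm (hme.trans he))
      (curve_intervalIntegrable_ell hγ h (hc.trans hcm) hme he)
    have hsup := W_superadditive h' (hγ.2.1 c ⟨hc, hcm.trans (hme.trans he)⟩)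
      (hA c m hc hcm (hme.trans he)) (hA m e (hc.trans hcm) hme he)
    simp only [R] at h1 h2 ⊢
    rw [← hadd, pow_succ]
    linarith
  have h0Q := hγ.2.1 0 ⟨le_rfl, zero_le_one⟩
  have hl0 : 0 ≤ level (γ 0) := add_nonneg (h0Q 0) (h0Q 1)
  have hfin := bisection (Φ := fun t => level (γ t))
    ((curve_continuousOn_coord hγ 0).add (curve_continuousOn_coord hγ 1)) base step hmono n 0 1
    le_rfl zero_le_one le_rfl (by linarith)
  have hΨle : Ψ (level (γ 1)) - Ψ (level (γ 0)) ≤ B.card * (4 * ρ) := by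
    simp only [hΨ]
    rw [← Finset.sum_sub_distrib, ← nsmul_eq_mul]
    refine Finset.sum_le_card_nsmul _ _ _ fun β _ => ?_
    have u1 : ψ β (level (γ 1)) ≤ β + 2 * ρ := max_le (by linarith) (min_le_right _ _)
    have u2 : β - 2 * ρ ≤ ψ β (level (γ 0)) := le_max_left _ _
    linarith
  have := mul_le_mul_of_nonneg_left hΨle (show 0 ≤ 2 * M by positivity)
  simp only [R] at hfin
  unfold J
  linarith

end Local

/-! ### From local domination to uniform convergence of the value functions -/

lemma isClosed_quad : IsClosed Quad := by
  have : Quad = ⋂ j : Fin 2, {x : Plane | 0 ≤ x j} := by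
    ext x
    simp [Quad]
  rw [this]
  exact isClosed_iInter fun j =>
    isClosed_le continuous_const (EuclideanSpace.proj (𝕜 := ℝ) j).continuous

lemma continuous_coord (j : Fin 2) : Continuous fun x : Plane => x j :=
  (EuclideanSpace.proj (𝕜 := ℝ) j).continuous

lemma continuous_level : Continuous level := (continuous_coord 0).add (continuous_coord 1)

lemma dist_le_abs_add_abs (x y : Plane) : dist x y ≤ |x 0 - y 0| + |x 1 - y 1| := by
  rw [EuclideanSpace.dist_eq, Fin.sum_univ_two, Real.sqrt_le_left (by positivity),
    Real.dist_eq, Real.dist_eq]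
  nlinarith [abs_nonneg (x 0 - y 0), abs_nonneg (x 1 - y 1)]

lemma abs_coord_sub_le_dist (x y : Plane) (j : Fin 2) : |x j - y j| ≤ dist x y := by
  rw [dist_eq_norm]
  exact PiLp.norm_apply_le (x - y) j

lemma isCompact_level_le (T : ℝ) : IsCompact {x : Plane | x ∈ Quad ∧ level x ≤ T} := by
  refine Metric.isCompact_of_isClosed_isBounded
    (isClosed_quad.inter (isClosed_le continuous_level continuous_const)) ?_
  refine (Metric.isBounded_closedBall (x := (0 : Plane)) (r := T)).subset ?_
  rintro x ⟨hx, hT⟩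
  have := dist_le_abs_add_abs x 0
  rw [Metric.mem_closedBall]
  simp only [PiLp.zero_apply, sub_zero, abs_of_nonneg (hx 0), abs_of_nonneg (hx 1)] at this
  exact this.trans hT

section Sequences

variable {M : ℝ} {μ σ : Plane → ℝ} {μk σk : ℕ → Plane → ℝ}

/-- Near `x` the costs `(μ_k, σ_k)` and `(μ, σ)` dominate each other, for large `k`, after small
displacements in the directions of some fixed quadrant. -/
def GoodAt (μ σ : Plane → ℝ) (μk σk : ℕ → Plane → ℝ) (x : Plane) : Prop :=
  ∃ R > 0, ∃ d : Fin 2 → ℝ, (∀ j, d j = 1 ∨ d j = -1) ∧ ∀ ε > 0, ∃ s₀ > 0, ∀ s, 0 < s → s < s₀ →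
    ∀ᶠ k in atTop, Dominates s ε d (Metric.ball x R ∩ Quad) (μk k) (σk k) μ σ ∧
      Dominates s ε d (Metric.ball x R ∩ Quad) μ σ (μk k) (σk k)

/-- On pieces of curve starting in `S` of level length at most `l`, energies of one cost are bounded
by values of the other, up to errors that vanish as `k → ∞`. -/
def ComparableOn (μ σ : Plane → ℝ) (μk σk : ℕ → Plane → ℝ) (l : ℝ) (S : Set Plane) : Prop :=
  ∀ ε > 0, ∀ᶠ k in atTop, ∀ γ ∈ MonotoneCurves, ∀ a b, 0 ≤ a → a ≤ b → b ≤ 1 → γ a ∈ S →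
    level (γ b) - level (γ a) ≤ l →
    ∫ t in a..b, ell (μk k) (σk k) (γ t) (derivWithin γ (Icc 0 1) t) ≤ W μ σ (γ a) (γ b) + ε ∧
    ∫ t in a..b, ell μ σ (γ t) (derivWithin γ (Icc 0 1) t) ≤ W (μk k) (σk k) (γ a) (γ b) + ε

lemma ComparableOn.mono {l l' : ℝ} {S S' : Set Plane} (h : ComparableOn μ σ μk σk l S)
    (hl : l' ≤ l) (hS : S' ⊆ S) : ComparableOn μ σ μk σk l' S' := fun ε hε =>
  (h ε hε).mono fun _ hk γ hγ a b ha hab hb haS hle =>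
    hk γ hγ a b ha hab hb (hS haS) (hle.trans hl)

lemma GoodAt.exists_comparableOn (h : Admissible M μ σ)
    (hk : ∀ᶠ k in atTop, Admissible M (μk k) (σk k)) {x : Plane} (hx : GoodAt μ σ μk σk x) :
    ∃ U ∈ 𝓝 x, ∃ l > 0, ComparableOn μ σ μk σk l U := by
  obtain ⟨R, hR, d, hd, H⟩ := hx
  refine ⟨Metric.ball x (R / 2), Metric.ball_mem_nhds x (by positivity), R / 4, by positivity, ?_⟩
  intro ε hε
  have hM := h.bound_nonneg
  set L := R / 4 with hL
  have hL0 : 0 < L := by positivity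
  -- `η` balances the two terms of the Cauchy-Schwarz error, and then `s` is chosen small.
  set η := ε / (4 * (M * L + 1)) with hη
  have hη0 : 0 < η := by positivity
  set ε' := ε / (8 * L) with hε'
  have hε'0 : 0 < ε' := by positivity
  obtain ⟨s₀, hs₀, Hs⟩ := H ε' hε'0
  have hB0 : 0 ≤ M * (1 + 1 / η) := by positivity
  set s := min (s₀ / 2) (ε / (8 * (M * (1 + 1 / η) + 1))) with hs
  have hs0 : 0 < s := by positivity
  have hss : s < s₀ := (min_le_left _ _).trans_lt (by linarith)
  have hbound : ∀ v, 0 ≤ v → v ≤ L →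
      (2 * ε' + M * η) * v + M * (1 + 1 / η) * (4 * s) ≤ ε := by
    intro v hv hvL
    have h1 : 2 * ε' * v ≤ ε / 4 := by
      have : 2 * ε' * v ≤ 2 * ε' * L := by gcongr
      have e : 2 * ε' * L = ε / 4 := by rw [hε']; field_simp; norm_num
      linarith
    have h2 : M * η * v ≤ ε / 4 := by
      have e1 : M * η * v ≤ M * η * L := by gcongr
      have e2 : M * η * L ≤ (M * L + 1) * η := by nlinarith
      have e3 : (M * L + 1) * η = ε / 4 := by rw [hη]; field_simp
      linarith
    have h3 : M * (1 + 1 / η) * (4 * s) ≤ ε / 2 := by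
      have e1 : s ≤ ε / (8 * (M * (1 + 1 / η) + 1)) := min_le_right _ _
      rw [le_div_iff₀ (by positivity)] at e1
      nlinarith
    linarith
  filter_upwards [Hs s hs0 hss, hk] with k hdom hadm γ hγ a b ha hab hb haU hle
  have hS : ∀ q : Plane, (∀ j, γ a j ≤ q j ∧ q j ≤ γ b j) → q ∈ Metric.ball x R ∩ Quad := by
    intro q hq
    have haQ := hγ.2.1 a ⟨ha, hab.trans hb⟩
    refine ⟨?_, fun j => (haQ j).trans (hq j).1⟩
    have h1 := dist_le_abs_add_abs q (γ a)
    rw [abs_of_nonneg (sub_nonneg.2 (hq 0).1), abs_of_nonneg (sub_nonneg.2 (hq 1).1)] at h1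
    have h2 := dist_triangle q (γ a) x
    rw [Metric.mem_ball] at haU ⊢
    simp only [level] at hle
    linarith [(hq 0).2, (hq 1).2]
  have hv0 : 0 ≤ (γ b 0 - γ a 0) + (γ b 1 - γ a 1) := add_nonneg
    (sub_nonneg.2 (curve_coord_mono hγ ha hab hb 0))
    (sub_nonneg.2 (curve_coord_mono hγ ha hab hb 1))
  have hvL : (γ b 0 - γ a 0) + (γ b 1 - γ a 1) ≤ L := by
    simp only [level] at hle
    linarith
  have hb' := hbound _ hv0 hvL
  exact ⟨(integral_ell_le_W_of_dominates hadm h hs0 hε'0.le hη0 hd hdom.1 hγ ha hab hb hS).trans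
      (add_le_add_right hb' _),
    (integral_ell_le_W_of_dominates h hadm hs0 hε'0.le hη0 hd hdom.2 hγ ha hab hb hS).trans
      (add_le_add_right hb' _)⟩

lemma exists_comparableOn_of_isCompact (h : Admissible M μ σ)
    (hk : ∀ᶠ k in atTop, Admissible M (μk k) (σk k)) {K : Set Plane} (hK : IsCompact K)
    (hgood : ∀ x ∈ K, GoodAt μ σ μk σk x) : ∃ l > 0, ComparableOn μ σ μk σk l K := by
  refine hK.induction_on (p := fun S => ∃ l > 0, ComparableOn μ σ μk σk l S) ?_ ?_ ?_ ?_
  · exact ⟨1, one_pos, fun ε _ => Eventually.of_forall fun k γ _ a b _ _ _ ha => ha.elim⟩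
  · rintro S S' hSS ⟨l, hl, hS'⟩
    exact ⟨l, hl, hS'.mono le_rfl hSS⟩
  · rintro S S' ⟨l, hl, hS⟩ ⟨l', hl', hS'⟩
    refine ⟨min l l', lt_min hl hl', fun ε hε => ?_⟩
    filter_upwards [hS ε hε, hS' ε hε] with k h1 h2 γ hγ a b ha hab hb haS hle
    rcases haS with haS | haS
    · exact h1 γ hγ a b ha hab hb haS (hle.trans (min_le_left _ _))
    · exact h2 γ hγ a b ha hab hb haS (hle.trans (min_le_right _ _))
  · intro x hx
    obtain ⟨U, hU, hl⟩ := (hgood x hx).exists_comparableOn h hk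
    exact ⟨U, mem_nhdsWithin_of_mem_nhds hU, hl⟩

/-- If all points outside finitely many levels are good, the value functions converge uniformly on
bounded sets. -/
lemma eventually_abs_W_sub_W_le (h : Admissible M μ σ)
    (hk : ∀ᶠ k in atTop, Admissible M (μk k) (σk k)) {T : ℝ} {B : Finset ℝ}
    (hgood : ∀ x ∈ Quad, level x ≤ T → level x ∉ B → GoodAt μ σ μk σk x) {ε : ℝ} (hε : 0 < ε) :
    ∀ᶠ k in atTop, ∀ z ∈ Quad, ∀ y ∈ Above z, level y ≤ T →
      |W (μk k) (σk k) z y - W μ σ z y| ≤ ε := by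
  have hM := h.bound_nonneg
  set ρ := ε / (16 * (M * B.card + 1)) with hρ
  have hρ0 : 0 < ρ := by positivity
  have hρε : 2 * M * (B.card * (4 * ρ)) ≤ ε / 2 := by
    have e : (M * B.card + 1) * ρ = ε / 16 := by rw [hρ]; field_simp
    nlinarith
  set K : Set Plane := {x | x ∈ Quad ∧ level x ≤ T} ∩ ⋂ β ∈ B, {x | ρ ≤ |level x - β|} with hKdef
  have hK : IsCompact K := (isCompact_level_le T).inter_right <|
    isClosed_biInter fun β _ =>
      isClosed_le continuous_const (continuous_level.sub continuous_const).abs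
  obtain ⟨l, hl, hcomp⟩ := exists_comparableOn_of_isCompact h hk hK fun x hx => by
    refine hgood x hx.1.1 hx.1.2 fun hxB => ?_
    have := mem_iInter₂.1 hx.2 (level x) hxB
    simp only [mem_ofPred_eq, sub_self, abs_zero] at this
    linarith
  set δ := min l ρ with hδ
  have hδ0 : 0 < δ := lt_min hl hρ0
  obtain ⟨n, hn⟩ := pow_unbounded_of_one_lt (T / δ) one_lt_two
  rw [div_lt_iff₀ hδ0] at hn
  have hε' : 0 < ε / (2 * 2 ^ n) := by positivity
  have e2 : 2 ^ n * (ε / (2 * 2 ^ n)) = ε / 2 := by field_simp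
  filter_upwards [hcomp _ hε', hk] with k hck hadm z hz y hy hyT
  have hmemK : ∀ x ∈ Quad, level x ≤ T → (∀ β ∈ B, ρ ≤ |level x - β|) → x ∈ K :=
    fun x hx hxT hxB => ⟨⟨hx, hxT⟩, mem_iInter₂.2 hxB⟩
  have h1 : W (μk k) (σk k) z y ≤ W μ σ z y + ε := by
    refine W_le hz hy fun γ hγ h0 h1 => ?_
    have := J_le_W_of_local hadm h (min_le_right l ρ) hρ0 hε'.le
      (fun γ hγ a b ha hab hb hle haT haB => (hck γ hγ a b ha hab hb
        (hmemK _ (hγ.2.1 a ⟨ha, hab.trans hb⟩) haT haB) (hle.trans (min_le_left _ _))).1)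
      hn.le hγ (h1 ▸ hyT)
    rw [h0, h1, e2] at this
    linarith
  have h2 : W μ σ z y ≤ W (μk k) (σk k) z y + ε := by
    refine W_le hz hy fun γ hγ h0 h1 => ?_
    have := J_le_W_of_local h hadm (min_le_right l ρ) hρ0 hε'.le
      (fun γ hγ a b ha hab hb hle haT haB => (hck γ hγ a b ha hab hb
        (hmemK _ (hγ.2.1 a ⟨ha, hab.trans hb⟩) haT haB) (hle.trans (min_le_left _ _))).2)
      hn.le hγ (h1 ▸ hyT)
    rw [h0, h1, e2] at this
    linarith
  rw [abs_le]
  constructor <;> linarith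

/-! ### Good points from relaxed limits -/

/-- On `U`, the function `h` increases along `g` up to a modulus of continuity; it may jump upwards
where `g` increases, but not downwards. -/
def IncreasesAlong (h g : Plane → ℝ) (U : Set Plane) : Prop :=
  ∀ ε > 0, ∃ δ > 0, ∀ w ∈ U, ∀ q ∈ U, g w < g q → dist w q < δ → h w ≤ h q + ε

lemma isOpen_openQuad : IsOpen OpenQuad := by
  have : OpenQuad = ⋂ j : Fin 2, {x : Plane | 0 < x j} := by
    ext x
    simp [OpenQuad]
  rw [this]
  exact isOpen_iInter_of_finite fun j => isOpen_lt continuous_const (continuous_coord j)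

lemma openQuad_subset_quad : OpenQuad ⊆ Quad := fun _ hx j => (hx j).le

variable {h : Plane → ℝ} {hk : ℕ → Plane → ℝ}

lemma eventually_lt_of_relaxedLimits (hlim : RelaxedLimits h hk)
    (hb : ∀ x ∈ Quad, 0 ≤ h x ∧ h x ≤ M)
    (hkb : ∀ᶠ k in atTop, ∀ x ∈ Quad, 0 ≤ hk k x ∧ hk k x ≤ M) {x : Plane} (hx : x ∈ OpenQuad)
    {c : ℝ} :
    ((∀ᶠ y in 𝓝 x, h y ≤ c) → ∀ c' > c, ∀ᶠ p in atTop ×ˢ 𝓝 x, hk p.1 p.2 < c') ∧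
    ((∀ᶠ y in 𝓝 x, c ≤ h y) → ∀ c' < c, ∀ᶠ p in atTop ×ˢ 𝓝 x, c' < hk p.1 p.2) := by
  have hQ : ∀ᶠ y in 𝓝 x, y ∈ Quad :=
    mem_of_superset (isOpen_openQuad.mem_nhds hx) openQuad_subset_quad
  have hkev : ∀ᶠ p in (atTop : Filter ℕ) ×ˢ 𝓝 x, 0 ≤ hk p.1 p.2 ∧ hk p.1 p.2 ≤ M := by
    filter_upwards [hkb.prod_mk hQ] with p hp using hp.1 _ hp.2
  have hev : ∀ᶠ y in 𝓝 x, 0 ≤ h y ∧ h y ≤ M := hQ.mono fun y hy => hb y hy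
  have bA : IsBoundedUnder (· ≤ ·) (𝓝 x) h :=
    isBoundedUnder_of_eventually_le (hev.mono fun _ h => h.2)
  have bB : IsBoundedUnder (· ≥ ·) (𝓝 x) h :=
    isBoundedUnder_of_eventually_ge (hev.mono fun _ h => h.1)
  have bC : IsBoundedUnder (· ≤ ·) (atTop ×ˢ 𝓝 x) (fun p : ℕ × Plane => hk p.1 p.2) :=
    isBoundedUnder_of_eventually_le (hkev.mono fun _ h => h.2)
  have bD : IsBoundedUnder (· ≥ ·) (atTop ×ˢ 𝓝 x) (fun p : ℕ × Plane => hk p.1 p.2) :=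
    isBoundedUnder_of_eventually_ge (hkev.mono fun _ h => h.1)
  constructor
  · intro hc c' hc'
    refine eventually_lt_of_limsup_lt ?_ bC
    exact ((hlim x hx).2.trans (limsup_le_of_le bB.isCoboundedUnder_le hc)).trans_lt hc'
  · intro hc c' hc'
    refine eventually_lt_of_lt_liminf ?_ bD
    exact hc'.trans_le ((le_liminf_of_le bA.isCoboundedUnder_ge hc).trans (hlim x hx).1)

/-- If the values of `h` near `w` are at most its values near `q` plus `c`, the relaxed limits allow
`h` to be replaced by `h_k` on either side. -/
lemma eventually_le_of_relaxedLimits (hlim : RelaxedLimits h hk)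
    (hb : ∀ x ∈ Quad, 0 ≤ h x ∧ h x ≤ M)
    (hkb : ∀ᶠ k in atTop, ∀ x ∈ Quad, 0 ≤ hk k x ∧ hk k x ≤ M) {w q : Plane}
    (hw : w ∈ OpenQuad) (hq : q ∈ OpenQuad) {c ε : ℝ} (hε : 0 < ε)
    (hev : ∀ᶠ p in 𝓝 (w, q), h p.1 ≤ h p.2 + c) :
    ∀ᶠ p in (atTop : Filter ℕ) ×ˢ 𝓝 (w, q),
      hk p.1 p.2.1 ≤ h p.2.2 + c + ε ∧ h p.2.1 ≤ hk p.1 p.2.2 + c + ε := by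
  rw [nhds_prod_eq] at hev
  obtain ⟨P, hP, Q, hQ, hPQ⟩ := eventually_prod_iff.1 hev
  have hP' : ∀ᶠ y in 𝓝 w, P y ∧ y ∈ Quad :=
    hP.and (mem_of_superset (isOpen_openQuad.mem_nhds hw) openQuad_subset_quad)
  -- The supremum of `h` near `w` separates the values of `h` near `w` from those near `q`.
  set A := sSup (h '' {y | P y ∧ y ∈ Quad}) with hA
  have hbdd : BddAbove (h '' {y | P y ∧ y ∈ Quad}) := by
    refine ⟨M, ?_⟩
    rintro _ ⟨y, hy, rfl⟩
    exact (hb y hy.2).2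
  have hleA : ∀ y, P y ∧ y ∈ Quad → h y ≤ A := fun y hy => le_csSup hbdd ⟨y, hy, rfl⟩
  have hAle : ∀ y, Q y → A ≤ h y + c := fun y hy => by
    refine csSup_le ⟨_, w, hP'.self_of_nhds, rfl⟩ ?_
    rintro _ ⟨y', hy', rfl⟩
    exact hPQ hy'.1 hy
  have t1 : Tendsto (fun p : ℕ × Plane × Plane => (p.1, p.2.1)) (atTop ×ˢ 𝓝 (w, q))
      (atTop ×ˢ 𝓝 w) :=
    tendsto_fst.prodMk ((continuous_fst.tendsto (w, q)).comp tendsto_snd)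
  have t2 : Tendsto (fun p : ℕ × Plane × Plane => (p.1, p.2.2)) (atTop ×ˢ 𝓝 (w, q))
      (atTop ×ˢ 𝓝 q) :=
    tendsto_fst.prodMk ((continuous_snd.tendsto (w, q)).comp tendsto_snd)
  have e1 := t1.eventually ((eventually_lt_of_relaxedLimits hlim hb hkb hw).1
    (hP'.mono hleA) (A + ε) (by linarith))
  have e2 := t2.eventually ((eventually_lt_of_relaxedLimits (c := A - c) hlim hb hkb hq).2
    (hQ.mono fun y hy => by linarith [hAle y hy]) (A - c - ε) (by linarith))
  have e3 := (tendsto_snd.comp t1).eventually hP'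
  have e4 := (tendsto_snd.comp t2).eventually hQ
  filter_upwards [e1, e2, e3, e4] with p h1 h2 h3 h4
  have h5 : h p.2.1 ≤ A := hleA _ h3
  have h6 : A ≤ h p.2.2 + c := hAle _ h4
  constructor <;> linarith

/-- One-function version of the mutual domination in `GoodAt`. -/
def DisplacedClose (h : Plane → ℝ) (hk : ℕ → Plane → ℝ) (d : Fin 2 → ℝ) (S : Set Plane) : Prop :=
  ∀ ε > 0, ∃ s₀ > 0, ∀ s, 0 < s → s < s₀ → ∀ᶠ k in atTop, ∀ w ∈ S, ∀ q ∈ S,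
    (∀ j, 0 ≤ d j * (q j - w j) ∧ d j * (q j - w j) ≤ 3 * s) →
    (∃ j, s ≤ d j * (q j - w j)) → hk k w ≤ h q + ε ∧ h w ≤ hk k q + ε

lemma dist_le_of_displaced {d : Fin 2 → ℝ} (hd : ∀ j, d j = 1 ∨ d j = -1) {w q : Plane} {s : ℝ}
    (h : ∀ j, 0 ≤ d j * (q j - w j) ∧ d j * (q j - w j) ≤ 3 * s) : dist w q ≤ 6 * s := by
  have habs : ∀ j, |w j - q j| ≤ 3 * s := fun j => by
    have := h j
    rcases hd j with e | e <;> rw [e] at this <;> rw [abs_le] <;> constructor <;> linarith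
  have := dist_le_abs_add_abs w q
  linarith [habs 0, habs 1]

lemma goodAt_of_displacedClose {x : Plane} {R : ℝ} (hR : 0 < R) {d : Fin 2 → ℝ}
    (hd : ∀ j, d j = 1 ∨ d j = -1) (hμ : DisplacedClose μ μk d (Metric.ball x R ∩ Quad))
    (hσ : DisplacedClose σ σk d (Metric.ball x R ∩ Quad)) : GoodAt μ σ μk σk x := by
  refine ⟨R, hR, d, hd, fun ε hε => ?_⟩
  obtain ⟨s₁, hs₁, h₁⟩ := hμ ε hε
  obtain ⟨s₂, hs₂, h₂⟩ := hσ ε hε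
  refine ⟨min s₁ s₂, lt_min hs₁ hs₂, fun s hs hss => ?_⟩
  filter_upwards [h₁ s hs (hss.trans_le (min_le_left _ _)),
    h₂ s hs (hss.trans_le (min_le_right _ _))] with k k₁ k₂
  exact ⟨fun w hw q hq e e' => ⟨(k₁ w hw q hq e e').1, (k₂ w hw q hq e e').1⟩,
    fun w hw q hq e e' => ⟨(k₁ w hw q hq e e').2, (k₂ w hw q hq e e').2⟩⟩

/-- Displacements across which a function increases are harmless for the relaxed limits: by
compactness, such a displacement of size `s` separates the neighbourhoods on which `h_k` is
controlled by `h`. -/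
lemma displacedClose_of_increasesAlong (hlim : RelaxedLimits h hk)
    (hb : ∀ x ∈ Quad, 0 ≤ h x ∧ h x ≤ M)
    (hkb : ∀ᶠ k in atTop, ∀ x ∈ Quad, 0 ≤ hk k x ∧ hk k x ≤ M) {x : Plane} {R : ℝ}
    {U : Set Plane} (hU : IsOpen U) (hUQ : U ⊆ OpenQuad) (hRU : Metric.closedBall x R ⊆ U)
    {g : Plane → ℝ} (hg : Continuous g) {d : Fin 2 → ℝ} (hd : ∀ j, d j = 1 ∨ d j = -1)
    (hgd : ∀ w q : Plane, w ∈ U → q ∈ U → (∀ j, 0 ≤ d j * (q j - w j)) →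
      (∃ j, 0 < d j * (q j - w j)) → g w < g q)
    (hinc : IncreasesAlong h g U) : DisplacedClose h hk d (Metric.ball x R ∩ Quad) := by
  intro ε hε
  obtain ⟨δ, hδ, hinc⟩ := hinc (ε / 2) (by positivity)
  refine ⟨δ / 6, by positivity, fun s hs hsδ => ?_⟩
  set K : Set (Plane × Plane) := (Metric.closedBall x R ×ˢ Metric.closedBall x R) ∩
    ({p | ∀ j, 0 ≤ d j * (p.2 j - p.1 j) ∧ d j * (p.2 j - p.1 j) ≤ 3 * s} ∩
      {p | ∃ j, s ≤ d j * (p.2 j - p.1 j)}) with hKdef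
  have hcont : ∀ j, Continuous fun p : Plane × Plane => d j * (p.2 j - p.1 j) := fun j =>
    continuous_const.mul (((continuous_coord j).comp continuous_snd).sub
      ((continuous_coord j).comp continuous_fst))
  have hK : IsCompact K := by
    refine ((isCompact_closedBall x R).prod (isCompact_closedBall x R)).inter_right
      (IsClosed.inter ?_ ?_)
    · simp only [ofPred_forall, ofPred_and]
      exact isClosed_iInter fun j => (isClosed_le continuous_const (hcont j)).inter
        (isClosed_le (hcont j) continuous_const)
    · simp only [ofPred_exists]
      exact isClosed_iUnion_of_finite fun j => isClosed_le continuous_const (hcont j)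
  have hloc : ∀ p ∈ K, ∀ᶠ r in (atTop : Filter ℕ) ×ˢ 𝓝 p,
      hk r.1 r.2.1 ≤ h r.2.2 + ε ∧ h r.2.1 ≤ hk r.1 r.2.2 + ε := by
    rintro ⟨w, q⟩ ⟨⟨hw, hq⟩, hd1, j₀, hd2⟩
    have hwU := hRU hw
    have hqU := hRU hq
    have hlt : g w < g q := hgd w q hwU hqU (fun j => (hd1 j).1) ⟨j₀, hs.trans_le hd2⟩
    have hdist : dist w q < δ := (dist_le_of_displaced hd hd1).trans_lt (by linarith)
    have hev : ∀ᶠ p in 𝓝 (w, q), h p.1 ≤ h p.2 + ε / 2 := by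
      have e1 : ∀ᶠ p : Plane × Plane in 𝓝 (w, q), p.1 ∈ U :=
        continuous_fst.continuousAt.eventually (hU.mem_nhds hwU)
      have e2 : ∀ᶠ p : Plane × Plane in 𝓝 (w, q), p.2 ∈ U :=
        continuous_snd.continuousAt.eventually (hU.mem_nhds hqU)
      have e3 : ∀ᶠ p : Plane × Plane in 𝓝 (w, q), g p.1 < g p.2 :=
        (isOpen_lt (hg.comp continuous_fst) (hg.comp continuous_snd)).mem_nhds hlt
      have e4 : ∀ᶠ p : Plane × Plane in 𝓝 (w, q), dist p.1 p.2 < δ :=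
        (isOpen_lt continuous_dist continuous_const).mem_nhds hdist
      filter_upwards [e1, e2, e3, e4] with p h1 h2 h3 h4 using hinc _ h1 _ h2 h3 h4
    filter_upwards [eventually_le_of_relaxedLimits hlim hb hkb (hUQ hwU) (hUQ hqU)
      (half_pos hε) hev] with r hr
    constructor <;> linarith [hr.1, hr.2]
  have hall : ∀ᶠ r in (atTop : Filter ℕ) ×ˢ 𝓝ˢ K,
      hk r.1 r.2.1 ≤ h r.2.2 + ε ∧ h r.2.1 ≤ hk r.1 r.2.2 + ε := by
    rw [hK.prod_nhdsSet_eq_biSup]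
    simpa only [eventually_iSup] using hloc
  filter_upwards [hall.curry] with k hk' w hw q hq h1 h2
  exact hk'.self_of_nhdsSet (w, q)
    ⟨⟨Metric.ball_subset_closedBall hw.1, Metric.ball_subset_closedBall hq.1⟩, h1, h2⟩

end Sequences

/-! ### Extending strictly monotone functions and strips around graphs -/

/-- The extension of `f` from `[a, b]` to the line by affine functions of slope one. -/
noncomputable def extendMono (a b : ℝ) (f : ℝ → ℝ) (t : ℝ) : ℝ :=
  f (max a (min b t)) + (t - max a (min b t))

section extendMono

variable {a b : ℝ} {f : ℝ → ℝ}

lemma extendMono_of_mem {t : ℝ} (ht : t ∈ Icc a b) : extendMono a b f t = f t := by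
  rw [extendMono, min_eq_right ht.2, max_eq_right ht.1, sub_self, add_zero]

lemma max_min_mem_Icc (hab : a ≤ b) (t : ℝ) : max a (min b t) ∈ Icc a b :=
  ⟨le_max_left _ _, max_le hab (min_le_left _ _)⟩

lemma continuous_extendMono (hab : a ≤ b) (hf : ContinuousOn f (Icc a b)) :
    Continuous (extendMono a b f) := by
  have hc : Continuous fun t : ℝ => max a (min b t) := by fun_prop
  exact (hf.comp_continuous hc (max_min_mem_Icc hab)).add (continuous_id.sub hc)

lemma strictMono_extendMono (hab : a ≤ b) (hf : StrictMonoOn f (Icc a b)) :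
    StrictMono (extendMono a b f) := by
  intro s t hst
  have hle : max a (min b s) ≤ max a (min b t) := by gcongr
  have hf' := hf.monotoneOn (max_min_mem_Icc hab s) (max_min_mem_Icc hab t) hle
  unfold extendMono
  rcases hle.eq_or_lt with he | hlt
  · rw [he]
    linarith
  · have := hf (max_min_mem_Icc hab s) (max_min_mem_Icc hab t) hlt
    have h2 : max a (min b t) - max a (min b s) ≤ t - s := by
      rcases max_cases a (min b t) with h1 | h1 <;> rcases max_cases a (min b s) with h2 | h2 <;>
        rcases min_cases b t with h3 | h3 <;> rcases min_cases b s with h4 | h4 <;> linarith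
    linarith

end extendMono

/-- The part of the strip of width `r` around the graph of `F` near `x` where the height above the
graph belongs to `K`. -/
def strip (F : ℝ → ℝ) (x : Plane) (r : ℝ) (K : Set ℝ) : Set Plane :=
  {w | w 0 ∈ Ioo (x 0 - r) (x 0 + r) ∧ w 1 - F (w 0) ∈ Ioo (-r) r ∩ K}

section Strip

variable {F : ℝ → ℝ} {x : Plane} {r : ℝ} {K : Set ℝ}

lemma continuous_graphMap (hF : Continuous F) :
    Continuous fun p : ℝ × ℝ => (!₂[p.1, F p.1 + p.2] : Plane) := by
  refine (PiLp.continuous_toLp 2 _).comp (continuous_pi fun j => ?_)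
  fin_cases j
  · exact continuous_fst
  · exact (hF.comp continuous_fst).add continuous_snd

lemma plane_ext {w q : Plane} (h0 : w 0 = q 0) (h1 : w 1 = q 1) : w = q := by
  ext j
  fin_cases j
  · exact h0
  · exact h1

/-- The shear straightening the graph of `F` shows that each side of the strip is connected. -/
lemma isPreconnected_strip (hF : Continuous F) (hK : K.OrdConnected) :
    IsPreconnected (strip F x r K) := by
  have : strip F x r K = (fun p : ℝ × ℝ => (!₂[p.1, F p.1 + p.2] : Plane)) ''
      (Ioo (x 0 - r) (x 0 + r) ×ˢ (Ioo (-r) r ∩ K)) := by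
    ext w
    constructor
    · rintro ⟨h0, h1⟩
      exact ⟨(w 0, w 1 - F (w 0)), ⟨h0, h1⟩, plane_ext rfl (add_sub_cancel _ _)⟩
    · rintro ⟨⟨t, u⟩, ⟨h0, h1⟩, rfl⟩
      refine ⟨h0, ?_⟩
      have : F t + u - F t = u := add_sub_cancel_left _ _
      change F t + u - F t ∈ _
      rw [this]
      exact h1
  rw [this]
  exact (isPreconnected_Ioo.prod (ordConnected_Ioo.inter hK).isPreconnected).image _
    (continuous_graphMap hF).continuousOn

lemma strip_subset_univ : strip F x r K ⊆ strip F x r univ := fun _ hw => ⟨hw.1, hw.2.1, trivial⟩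

lemma continuous_height (hF : Continuous F) : Continuous fun w : Plane => w 1 - F (w 0) :=
  (continuous_coord 1).sub (hF.comp (continuous_coord 0))

lemma isOpen_strip (hF : Continuous F) : IsOpen (strip F x r univ) := by
  have : strip F x r univ = (fun w : Plane => w 0) ⁻¹' Ioo (x 0 - r) (x 0 + r) ∩
      (fun w : Plane => w 1 - F (w 0)) ⁻¹' Ioo (-r) r := by
    ext w
    simp [strip]
  rw [this]
  exact (isOpen_Ioo.preimage (continuous_coord 0)).inter
    (isOpen_Ioo.preimage (continuous_height hF))

lemma mem_strip_self (hr : 0 < r) (hx : x 1 = F (x 0)) (h0 : (0 : ℝ) ∈ K) : x ∈ strip F x r K := by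
  refine ⟨⟨by linarith, by linarith⟩, ?_⟩
  rw [hx, sub_self]
  exact ⟨⟨by linarith, hr⟩, h0⟩

lemma exists_strip_subset (hF : Continuous F) (hx : x 1 = F (x 0)) {V : Set Plane}
    (hV : V ∈ 𝓝 x) : ∃ r > 0, strip F x r univ ⊆ V := by
  have hx' : (fun p : ℝ × ℝ => (!₂[p.1, F p.1 + p.2] : Plane)) (x 0, 0) = x :=
    plane_ext rfl (by simp [hx])
  have h : Tendsto (fun p : ℝ × ℝ => (!₂[p.1, F p.1 + p.2] : Plane)) (𝓝 (x 0, 0)) (𝓝 x) := by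
    have := (continuous_graphMap hF).tendsto (x 0, 0)
    rwa [show (!₂[((x 0, 0) : ℝ × ℝ).1, F ((x 0, 0) : ℝ × ℝ).1 + ((x 0, 0) : ℝ × ℝ).2] : Plane) = x
      from hx'] at this
  obtain ⟨r, hr, hsub⟩ := Metric.mem_nhds_iff.1 (h hV)
  refine ⟨r, hr, fun w hw => ?_⟩
  have hmem : ((w 0, w 1 - F (w 0)) : ℝ × ℝ) ∈ Metric.ball (x 0, (0 : ℝ)) r := by
    rw [Metric.mem_ball, Prod.dist_eq, max_lt_iff, Real.dist_eq, Real.dist_eq, abs_lt, abs_lt]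
    obtain ⟨⟨h1, h2⟩, ⟨h3, h4⟩, -⟩ := hw
    refine ⟨⟨?_, ?_⟩, ?_, ?_⟩ <;> simp only [sub_zero] <;> linarith
  have := hsub hmem
  have e : (!₂[w 0, F (w 0) + (w 1 - F (w 0))] : Plane) = w := plane_ext rfl (add_sub_cancel _ _)
  exact e ▸ this

end Strip

/-! ### The curve `Γ` and the set `Ω` -/

namespace Geometry

variable (D : Geometry)

/-- A defining function of `Γ`: it vanishes on `Γ`, is negative exactly on `Ω` within the quadrant,
and is strictly increasing in both coordinates. -/
noncomputable def psi (x : Plane) : ℝ := x 1 - -extendMono 0 1 (fun t => -D.g t) (x 0)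

lemma continuous_negExtend : Continuous fun t => -extendMono 0 1 (fun t => -D.g t) t :=
  (continuous_extendMono zero_le_one D.g_cont.neg).neg

lemma continuous_psi : Continuous D.psi := continuous_height D.continuous_negExtend

lemma strictMono_extend_g : StrictMono (extendMono 0 1 (fun t => -D.g t)) :=
  strictMono_extendMono zero_le_one D.g_anti.neg

lemma psi_mono {w q : Plane} (h : ∀ j, w j ≤ q j) : D.psi w ≤ D.psi q := by
  have := D.strictMono_extend_g.monotone (h 0)
  have := h 1
  unfold psi
  linarith

lemma psi_lt {w q : Plane} (h : ∀ j, w j ≤ q j) (h' : ∃ j, w j < q j) : D.psi w < D.psi q := by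
  have m := D.strictMono_extend_g.monotone (h 0)
  have h1 := h 1
  obtain ⟨j, hj⟩ := h'
  fin_cases j
  · have := D.strictMono_extend_g hj
    simp only [Fin.zero_eta] at this
    unfold psi
    linarith
  · simp only [Fin.mk_one] at hj
    unfold psi
    linarith

lemma psi_of_mem {x : Plane} (h : x 0 ∈ Icc (0 : ℝ) 1) : D.psi x = x 1 - D.g (x 0) := by
  rw [psi, extendMono_of_mem h, neg_neg]

lemma psi_pos_of_one_lt {x : Plane} (hx : x ∈ Quad) (h : 1 < x 0) : 0 < D.psi x := by
  have := D.strictMono_extend_g h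
  rw [extendMono_of_mem ⟨zero_le_one, le_rfl⟩, D.g_one] at this
  have := hx 1
  unfold psi
  linarith

lemma mem_Gam_iff {x : Plane} (hx : x ∈ Quad) : x ∈ D.Gam ↔ D.psi x = 0 := by
  constructor
  · rintro ⟨h0, h1⟩
    rw [D.psi_of_mem h0, h1, sub_self]
  · intro h
    have h0 : x 0 ∈ Icc (0 : ℝ) 1 := by
      refine ⟨hx 0, ?_⟩
      by_contra! hlt
      exact (D.psi_pos_of_one_lt hx hlt).ne' h
    rw [D.psi_of_mem h0, sub_eq_zero] at h
    exact ⟨h0, h⟩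

lemma Gam_subset_quad : D.Gam ⊆ Quad := by
  rintro x ⟨h0, h1⟩ j
  fin_cases j
  · exact h0.1
  · have := D.g_anti.antitoneOn h0 ⟨zero_le_one, le_rfl⟩ h0.2
    rw [D.g_one, ← h1] at this
    exact this

lemma isClosed_Gam : IsClosed D.Gam := by
  have : D.Gam = Quad ∩ {x | D.psi x = 0} := by
    ext x
    exact ⟨fun h => ⟨D.Gam_subset_quad h, (D.mem_Gam_iff (D.Gam_subset_quad h)).1 h⟩,
      fun h => (D.mem_Gam_iff h.1).2 h.2⟩
  rw [this]
  exact isClosed_quad.inter (isClosed_eq D.continuous_psi continuous_const)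

lemma Gam_nonempty : D.Gam.Nonempty :=
  ⟨!₂[0, 1], ⟨⟨le_rfl, zero_le_one⟩, D.g_zero.symm⟩⟩

/-- The bounded component lies exactly below `Γ`: a component of the complement of `Γ` cannot leave
`{psi < 0}`, which is bounded, and every component above `Γ` contains a diagonal ray. -/
lemma mem_Om_iff {x : Plane} : x ∈ D.Om ↔ x ∈ Quad ∧ D.psi x < 0 := by
  have hne : ∀ y ∈ Quad \ D.Gam, D.psi y ≠ 0 := fun y hy h => hy.2 ((D.mem_Gam_iff hy.1).2 h)
  constructor
  · rintro ⟨hx, hb⟩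
    refine ⟨hx.1, ?_⟩
    by_contra! hge
    have hpos : 0 < D.psi x := lt_of_le_of_ne hge (hne x hx).symm
    set ray : ℝ → Plane := fun t => !₂[x 0 + t, x 1 + t] with hray
    have hrc : Continuous ray := by
      refine (PiLp.continuous_toLp 2 _).comp (continuous_pi fun j => ?_)
      fin_cases j
      · exact continuous_const.add continuous_id
      · exact continuous_const.add continuous_id
    have hle : ∀ t ∈ Ici (0 : ℝ), ∀ j, x j ≤ ray t j := by
      intro t ht j
      have : (0 : ℝ) ≤ t := ht
      fin_cases j
      · change x 0 ≤ x 0 + t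
        linarith
      · change x 1 ≤ x 1 + t
        linarith
    have hsub : ray '' Ici 0 ⊆ Quad \ D.Gam := by
      rintro _ ⟨t, ht, rfl⟩
      have hq : ray t ∈ Quad := fun j => (hx.1 j).trans (hle t ht j)
      refine ⟨hq, fun hG => ?_⟩
      have := D.psi_mono (hle t ht)
      rw [(D.mem_Gam_iff hq).1 hG] at this
      linarith
    have hx0 : ray 0 = x := plane_ext (by simp [hray]) (by simp [hray])
    have hcc := (isPreconnected_Ici.image ray hrc.continuousOn).subset_connectedComponentIn
      (x := x) ⟨0, mem_Ici.2 le_rfl, hx0⟩ hsub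
    obtain ⟨C, hC⟩ := (hb.subset hcc).exists_norm_le
    have h1 := hC (ray (|C| + 1)) ⟨|C| + 1, mem_Ici.2 (by positivity), rfl⟩
    have h2 := abs_coord_sub_le_dist (ray (|C| + 1)) 0 0
    rw [dist_zero_right] at h2
    have h3 : |C| + 1 ≤ |ray (|C| + 1) 0 - (0 : Plane) 0| := by
      refine le_trans ?_ (le_abs_self _)
      have := hx.1 0
      have e : ray (|C| + 1) 0 - (0 : Plane) 0 = x 0 + (|C| + 1) := by simp [hray]
      rw [e]
      linarith
    linarith [le_abs_self C]
  · rintro ⟨hx, hneg⟩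
    have hxG : x ∈ Quad \ D.Gam := ⟨hx, fun h => hneg.ne ((D.mem_Gam_iff hx).1 h)⟩
    refine ⟨hxG, ?_⟩
    have hsub : connectedComponentIn (Quad \ D.Gam) x ⊆ {y | D.psi y < 0} := by
      refine isPreconnected_connectedComponentIn.subset_left_of_subset_union
        (v := {y | 0 < D.psi y}) (isOpen_lt D.continuous_psi continuous_const)
        (isOpen_lt continuous_const D.continuous_psi) ?_ ?_
        ⟨x, mem_connectedComponentIn hxG, hneg⟩
      · exact disjoint_left.2 fun y (h1 : D.psi y < 0) (h2 : 0 < D.psi y) => lt_asymm h1 h2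
      · exact fun y hy => lt_or_gt_of_ne (hne y (connectedComponentIn_subset _ _ hy))
    refine (Metric.isBounded_closedBall (x := (0 : Plane)) (r := 2)).subset fun y hy => ?_
    have hyQ := (connectedComponentIn_subset _ _ hy).1
    have hyneg : D.psi y < 0 := hsub hy
    have hy0 : y 0 ≤ 1 := by
      by_contra! hlt
      exact (D.psi_pos_of_one_lt hyQ hlt).not_gt hyneg
    have hy1 : y 1 ≤ 1 := by
      rw [D.psi_of_mem ⟨hyQ 0, hy0⟩] at hyneg
      have := D.g_anti.antitoneOn ⟨le_rfl, zero_le_one⟩ ⟨hyQ 0, hy0⟩ (hyQ 0)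
      rw [D.g_zero] at this
      linarith
    have := dist_le_abs_add_abs y 0
    simp only [PiLp.zero_apply, sub_zero, abs_of_nonneg (hyQ 0), abs_of_nonneg (hyQ 1)] at this
    rw [Metric.mem_closedBall]
    linarith

/-- The outer set `[0,∞)² \ Ω`. -/
def outer : Set Plane := Quad \ D.Om

lemma mem_outer_iff {x : Plane} : x ∈ D.outer ↔ x ∈ Quad ∧ 0 ≤ D.psi x := by
  rw [outer, Set.mem_sdiff, mem_Om_iff]
  constructor
  · rintro ⟨h1, h2⟩
    exact ⟨h1, not_lt.1 fun h => h2 ⟨h1, h⟩⟩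
  · rintro ⟨h1, h2⟩
    exact ⟨h1, fun h => h2.not_gt h.2⟩

lemma isClosed_outer : IsClosed D.outer := by
  have : D.outer = Quad ∩ {x | 0 ≤ D.psi x} := by
    ext x
    exact D.mem_outer_iff
  rw [this]
  exact isClosed_quad.inter (isClosed_le continuous_const D.continuous_psi)

/-! ### The curves `Γ_i` -/

/-- The first coordinate of the lower left endpoint of `Γ_i`. -/
noncomputable def start (i : ℤ) : ℝ := (D.f_start i).choose

lemma isLeast_start (i : ℤ) : IsLeast (D.I i) (D.start i) := (D.f_start i).choose_spec.1

lemma start_mem_outer (i : ℤ) : (!₂[D.start i, D.f i (D.start i)] : Plane) ∈ D.outer :=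
  D.isClosed_outer.frontier_subset (D.f_start i).choose_spec.2

lemma start_mem_curve (i : ℤ) : (!₂[D.start i, D.f i (D.start i)] : Plane) ∈ D.curve i :=
  ⟨(D.isLeast_start i).1, rfl⟩

lemma curve_coord_ge {i : ℤ} {x : Plane} (hx : x ∈ D.curve i) (j : Fin 2) :
    (!₂[D.start i, D.f i (D.start i)] : Plane) j ≤ x j := by
  have hle : D.start i ≤ x 0 := (D.isLeast_start i).2 hx.1
  fin_cases j
  · exact hle
  · change D.f i (D.start i) ≤ x 1
    rw [hx.2]
    exact (D.f_mono i).monotoneOn (D.isLeast_start i).1 hx.1 hle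

lemma curve_subset_outer (i : ℤ) : D.curve i ⊆ D.outer := fun x hx => by
  have h := D.mem_outer_iff.1 (D.start_mem_outer i)
  exact D.mem_outer_iff.2 ⟨fun j => (h.1 j).trans (D.curve_coord_ge hx j),
    h.2.trans (D.psi_mono (D.curve_coord_ge hx))⟩

lemma interior_of_mem_curve {i : ℤ} {x : Plane} (hx : x ∈ D.curve i) (hne : x 0 ≠ D.start i) :
    x ∈ OpenQuad ∧ 0 < D.psi x := by
  have hlt : D.start i < x 0 := lt_of_le_of_ne ((D.isLeast_start i).2 hx.1) hne.symm
  have hlt1 : D.f i (D.start i) < x 1 := by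
    rw [hx.2]
    exact D.f_mono i (D.isLeast_start i).1 hx.1 hlt
  have h := D.mem_outer_iff.1 (D.start_mem_outer i)
  refine ⟨fun j => ?_, h.2.trans_lt (D.psi_lt (D.curve_coord_ge hx) ⟨0, hlt⟩)⟩
  have := h.1 j
  fin_cases j
  · exact lt_of_le_of_lt this hlt
  · exact lt_of_le_of_lt this hlt1

/-- `Γ_i` is unbounded, so its parameters and heights cannot both be bounded above. -/
lemma not_bounded_curve {i : ℤ} {c c' : ℝ} (h : ∀ t ∈ D.I i, t ≤ c ∧ D.f i t ≤ c') : False := by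
  refine D.f_unbounded i ?_
  refine (Metric.isBounded_closedBall (x := (0 : Plane)) (r := c + c')).subset fun x hx => ?_
  have hxQ := (D.mem_outer_iff.1 (D.curve_subset_outer i hx)).1
  have hd := dist_le_abs_add_abs x 0
  simp only [PiLp.zero_apply, sub_zero, abs_of_nonneg (hxQ 0), abs_of_nonneg (hxQ 1)] at hd
  have h1 := h _ hx.1
  rw [← hx.2] at h1
  rw [Metric.mem_closedBall]
  linarith

lemma exists_gt_mem_I {i : ℤ} {t : ℝ} (ht : t ∈ D.I i) : ∃ b ∈ D.I i, t < b := by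
  by_contra! hle
  exact D.not_bounded_curve (i := i) fun s hs =>
    ⟨hle s hs, (D.f_mono i).monotoneOn hs ht (hle s hs)⟩

lemma isClosed_curve (i : ℤ) : IsClosed (D.curve i) := by
  refine isClosed_of_closure_subset fun y hy => ?_
  have hstart : D.start i ≤ y 0 := by
    have : closure (D.curve i) ⊆ {x | D.start i ≤ x 0} :=
      closure_minimal (fun x hx => (D.isLeast_start i).2 hx.1)
        (isClosed_le continuous_const (continuous_coord 0))
    exact this hy
  -- If the curve did not reach the abscissa of `y` it would be bounded.
  have hyI : y 0 ∈ D.I i := by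
    by_contra hnot
    have hlt : ∀ t ∈ D.I i, t < y 0 := fun t ht => by
      by_contra! hle
      exact hnot ((D.I_interval i).out (D.isLeast_start i).1 ht ⟨hstart, hle⟩)
    refine D.not_bounded_curve (i := i) (c := y 0) (c' := y 1 + 1) fun t ht => ⟨(hlt t ht).le, ?_⟩
    obtain ⟨w, hw, hd⟩ := Metric.mem_closure_iff.1 hy (min 1 (y 0 - t))
      (lt_min one_pos (sub_pos.2 (hlt t ht)))
    have h0 := abs_lt.1 ((abs_coord_sub_le_dist y w 0).trans_lt (hd.trans_le (min_le_right _ _)))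
    have h1 := abs_lt.1 ((abs_coord_sub_le_dist y w 1).trans_lt (hd.trans_le (min_le_left _ _)))
    have := (D.f_mono i).monotoneOn ht hw.1 (by linarith [h0.2])
    rw [← hw.2] at this
    linarith [h1.1]
  obtain ⟨b, hb, hyb⟩ := D.exists_gt_mem_I hyI
  have hIcc : Icc (D.start i) b ⊆ D.I i := (D.I_interval i).out (D.isLeast_start i).1 hb
  have hcont := continuous_extendMono (hstart.trans hyb.le) ((D.f_cont i).mono hIcc)
  have hcl : y ∈ closure ({x : Plane | x 0 < b} ∩ D.curve i) :=
    (isOpen_lt (continuous_coord 0) continuous_const).inter_closure ⟨hyb, hy⟩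
  have hsub : {x : Plane | x 0 < b} ∩ D.curve i ⊆
      {x | x 1 = extendMono (D.start i) b (D.f i) (x 0)} := by
    rintro x ⟨hxb, hx⟩
    have hxb' : x 0 < b := hxb
    rw [mem_ofPred_eq, extendMono_of_mem ⟨(D.isLeast_start i).2 hx.1, hxb'.le⟩]
    exact hx.2
  have := closure_minimal hsub
    (isClosed_eq (continuous_coord 1) (hcont.comp (continuous_coord 0))) hcl
  rw [mem_ofPred_eq, extendMono_of_mem ⟨hstart, hyb.le⟩] at this
  exact ⟨hyI, this⟩

lemma isClosed_iUnion_curve : IsClosed (⋃ i, D.curve i) :=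
  D.curves_locallyFinite.isClosed_iUnion D.isClosed_curve

/-! ### The regions `Ω_i` -/

/-- The outer set with all curves `Γ_i` removed; its components are the regions. -/
def free : Set Plane := D.outer \ ⋃ i, D.curve i

lemma region_subset_free (i : ℤ) : D.region i ⊆ D.free := by
  obtain ⟨x, -, h⟩ := D.region_component i
  rw [h]
  exact connectedComponentIn_subset _ _

lemma subset_region {i : ℤ} {S : Set Plane} (hS : IsPreconnected S) (hSF : S ⊆ D.free) {y : Plane}
    (hy : y ∈ S) (hyi : y ∈ D.region i) : S ⊆ D.region i := by
  obtain ⟨x, -, h⟩ := D.region_component i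
  rw [h] at hyi ⊢
  rw [connectedComponentIn_eq hyi]
  exact hS.subset_connectedComponentIn hy hSF

lemma exists_subset_region {S : Set Plane} (hS : IsPreconnected S) (hSF : S ⊆ D.free)
    (hne : S.Nonempty) : ∃ i, S ⊆ D.region i := by
  obtain ⟨y, hy⟩ := hne
  obtain ⟨i, hi⟩ := mem_iUnion.1 (D.region_cover (hSF hy))
  exact ⟨i, D.subset_region hS hSF hy hi⟩

lemma region_eq_of_mem {i j : ℤ} {y : Plane} (hi : y ∈ D.region i) (hj : y ∈ D.region j) :
    D.region i = D.region j := by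
  have hp : ∀ k, IsPreconnected (D.region k) := fun k => by
    obtain ⟨x, -, h⟩ := D.region_component k
    rw [h]
    exact isPreconnected_connectedComponentIn
  exact (D.subset_region (hp i) (D.region_subset_free i) hi hj).antisymm
    (D.subset_region (hp j) (D.region_subset_free j) hj hi)

lemma region_ne (i : ℤ) : D.region i ≠ D.region (i - 1) := by
  intro h
  have h1 := (D.region_label (i + 1) i).2 (Or.inr (by ring))
  rw [h, D.region_label] at h1
  omega

/-- Near a point of `Γ_i` other than its endpoint, `Γ_i` is the graph of a strictly increasing
function whose two sides belong to the two adjacent regions. -/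
lemma exists_strip_curve {i : ℤ} {x : Plane} (hx : x ∈ D.curve i) (hne : x 0 ≠ D.start i)
    {V : Set Plane} (hV : V ∈ 𝓝 x) :
    ∃ F : ℝ → ℝ, Continuous F ∧ StrictMono F ∧ x 1 = F (x 0) ∧ ∃ r > 0, strip F x r univ ⊆ V ∧
      (∀ w ∈ strip F x r univ, w 1 - F (w 0) = 0 → w ∈ D.curve i) ∧
      ((strip F x r (Ioi 0) ⊆ D.region i ∧ strip F x r (Iio 0) ⊆ D.region (i - 1)) ∨
        (strip F x r (Ioi 0) ⊆ D.region (i - 1) ∧ strip F x r (Iio 0) ⊆ D.region i)) := by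
  have hlt : D.start i < x 0 := lt_of_le_of_ne ((D.isLeast_start i).2 hx.1) hne.symm
  obtain ⟨b, hb, hxb⟩ := D.exists_gt_mem_I hx.1
  have hIcc : Icc (D.start i) b ⊆ D.I i := (D.I_interval i).out (D.isLeast_start i).1 hb
  have hsb := hlt.trans hxb
  obtain ⟨hxO, hxpsi⟩ := D.interior_of_mem_curve hx hne
  set F := extendMono (D.start i) b (D.f i) with hF
  have hFc : Continuous F := continuous_extendMono hsb.le ((D.f_cont i).mono hIcc)
  have hFm : StrictMono F := strictMono_extendMono hsb.le ((D.f_mono i).mono hIcc)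
  have hFeq : ∀ t ∈ Icc (D.start i) b, F t = D.f i t := fun t ht => extendMono_of_mem ht
  have hxF : x 1 = F (x 0) := by
    rw [hFeq _ ⟨hlt.le, hxb.le⟩]
    exact hx.2
  -- A neighbourhood of `x` that meets no other curve and lies above `Γ`.
  have hothers : IsClosed (⋃ j : {j : ℤ // j ≠ i}, D.curve j) :=
    (D.curves_locallyFinite.comp_injective Subtype.val_injective).isClosed_iUnion
      fun j => D.isClosed_curve j
  have hxothers : x ∉ ⋃ j : {j : ℤ // j ≠ i}, D.curve j := by
    rw [mem_iUnion]
    rintro ⟨⟨j, hj⟩, hxj⟩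
    exact disjoint_left.1 (D.curves_disjoint hj) hxj hx
  have hV' : V ∩ (OpenQuad ∩ ({w | 0 < D.psi w} ∩ ((⋃ j : {j : ℤ // j ≠ i}, D.curve j)ᶜ ∩
      ({w : Plane | D.start i < w 0} ∩ {w : Plane | w 0 < b})))) ∈ 𝓝 x :=
    inter_mem hV <| inter_mem (isOpen_openQuad.mem_nhds hxO) <|
      inter_mem ((isOpen_lt continuous_const D.continuous_psi).mem_nhds hxpsi) <|
      inter_mem (hothers.isOpen_compl.mem_nhds hxothers) <|
      inter_mem ((isOpen_lt continuous_const (continuous_coord 0)).mem_nhds hlt)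
        ((isOpen_lt (continuous_coord 0) continuous_const).mem_nhds hxb)
  obtain ⟨r, hr, hsub⟩ := exists_strip_subset hFc hxF hV'
  have hcurve : ∀ w ∈ strip F x r univ, w ∈ D.curve i ↔ w 1 - F (w 0) = 0 := by
    intro w hw
    obtain ⟨-, -, -, -, h1, h2⟩ := hsub hw
    have hw0 : w 0 ∈ Icc (D.start i) b := ⟨le_of_lt h1, le_of_lt h2⟩
    rw [hFeq _ hw0, sub_eq_zero]
    exact ⟨fun h => h.2, fun h => ⟨hIcc hw0, h⟩⟩
  have hfree : ∀ w ∈ strip F x r univ, w 1 - F (w 0) ≠ 0 → w ∈ D.free := by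
    intro w hw h0
    obtain ⟨-, h1, h2, h3, -⟩ := hsub hw
    refine ⟨D.mem_outer_iff.2 ⟨openQuad_subset_quad h1, le_of_lt h2⟩, fun hU => ?_⟩
    obtain ⟨j, hj⟩ := mem_iUnion.1 hU
    by_cases hji : j = i
    · subst hji
      exact h0 ((hcurve w hw).1 hj)
    · exact h3 (mem_iUnion.2 ⟨⟨j, hji⟩, hj⟩)
  have hside : ∀ u : ℝ, -r < u → u < r → ∀ K : Set ℝ, u ∈ K →
      (!₂[x 0, F (x 0) + u] : Plane) ∈ strip F x r K := by
    intro u h1 h2 K hK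
    refine ⟨⟨?_, ?_⟩, ?_⟩
    · change x 0 - r < x 0
      linarith
    · change x 0 < x 0 + r
      linarith
    · change F (x 0) + u - F (x 0) ∈ _
      rw [add_sub_cancel_left]
      exact ⟨⟨h1, h2⟩, hK⟩
  obtain ⟨m, hm⟩ := D.exists_subset_region (isPreconnected_strip (x := x) (r := r) hFc
    (ordConnected_Ioi (a := (0 : ℝ))))
    (fun w hw => hfree w (strip_subset_univ hw) (ne_of_gt hw.2.2))
    ⟨_, hside (r / 2) (by linarith) (by linarith) _ (half_pos hr)⟩
  obtain ⟨m', hm'⟩ := D.exists_subset_region (isPreconnected_strip (x := x) (r := r) hFc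
    (ordConnected_Iio (a := (0 : ℝ))))
    (fun w hw => hfree w (strip_subset_univ hw) (ne_of_lt hw.2.2))
    ⟨_, hside (-(r / 2)) (by linarith) (by linarith) _ (by
      rw [mem_Iio]
      linarith)⟩
  -- Both adjacent regions meet the strip, so they are the regions of its two sides.
  have hadj : ∀ j, j = i ∨ j = i - 1 → D.region m = D.region j ∨ D.region m' = D.region j := by
    intro j hj
    have hcl : x ∈ closure (D.region j) := frontier_subset_closure ((D.region_label i j).2 hj hx)
    obtain ⟨w, hw, hwj⟩ := mem_closure_iff_nhds.1 hcl _
      ((isOpen_strip hFc).mem_nhds (mem_strip_self hr hxF (mem_univ 0)))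
    have hw0 : w 1 - F (w 0) ≠ 0 := fun h0 =>
      (D.region_subset_free j hwj).2 (mem_iUnion.2 ⟨i, (hcurve w hw).2 h0⟩)
    rcases lt_or_gt_of_ne hw0 with h | h
    · exact Or.inr (D.region_eq_of_mem (hm' ⟨hw.1, hw.2.1, h⟩) hwj)
    · exact Or.inl (D.region_eq_of_mem (hm ⟨hw.1, hw.2.1, h⟩) hwj)
  refine ⟨F, hFc, hFm, hxF, r, hr, fun w hw => (hsub hw).1, fun w hw => (hcurve w hw).2, ?_⟩
  have hne' := D.region_ne i
  rcases hadj i (Or.inl rfl) with h1 | h1 <;> rcases hadj (i - 1) (Or.inr rfl) with h2 | h2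
  · exact absurd (h1.symm.trans h2) hne'
  · exact Or.inl ⟨h1 ▸ hm, h2 ▸ hm'⟩
  · exact Or.inr ⟨h2 ▸ hm, h1 ▸ hm'⟩
  · exact absurd (h1.symm.trans h2) hne'

end Geometry

/-! ### Good points -/

lemma exists_lipschitz_modulus (C : NNReal) {ε : ℝ} (hε : 0 < ε) :
    ∃ δ > 0, ∀ (h : Plane → ℝ) (N : Set Plane), LipschitzOnWith C h N →
      ∀ w ∈ N, ∀ q ∈ N, dist w q < δ → |h w - h q| ≤ ε := by
  refine ⟨ε / (C + 1), by positivity, fun h N hL w hw q hq hd => ?_⟩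
  have h1 := hL.dist_le_mul w hw q hq
  rw [Real.dist_eq] at h1
  rw [lt_div_iff₀ (by positivity)] at hd
  nlinarith [dist_nonneg (x := w) (y := q)]

lemma abs_sub_le_of_abs_sq_sub_sq_le {a b ε : ℝ} (ha : 0 ≤ a) (hb : 0 ≤ b) (hε : 0 ≤ ε)
    (h : |a ^ 2 - b ^ 2| ≤ ε ^ 2) : |a - b| ≤ ε := by
  rw [abs_le] at h ⊢
  constructor <;> by_contra! hlt <;> nlinarith

section Sequences

variable {M : ℝ} {μ σ : Plane → ℝ} {μk σk : ℕ → Plane → ℝ} {h : Plane → ℝ} {hk : ℕ → Plane → ℝ}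

lemma IncreasesAlong.of_sq {g : Plane → ℝ} {U : Set Plane} (hσ : ∀ x ∈ U, 0 ≤ σ x)
    (hinc : IncreasesAlong (fun x => σ x ^ 2) g U) : IncreasesAlong σ g U := by
  intro ε hε
  obtain ⟨δ, hδ, H⟩ := hinc (ε ^ 2) (by positivity)
  refine ⟨δ, hδ, fun w hw q hq hg hd => ?_⟩
  have h1 := H w hw q hq hg hd
  have h2 := hσ q hq
  simp only at h1
  by_contra! hlt
  nlinarith

/-- At a point where the functions `h` and `h_k` are equicontinuous up to the boundary of the
quadrant, the relaxed limits in the interior give uniform convergence. -/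
lemma displacedClose_of_equicontinuous (hlim : RelaxedLimits h hk)
    (hb : ∀ x ∈ Quad, 0 ≤ h x ∧ h x ≤ M)
    (hkb : ∀ᶠ k in atTop, ∀ x ∈ Quad, 0 ≤ hk k x ∧ hk k x ≤ M) {x : Plane} {R : ℝ} (hR : 0 < R)
    (hequi : ∀ ε > 0, ∃ δ > 0,
      (∀ w ∈ Metric.ball x R ∩ Quad, ∀ q ∈ Metric.ball x R ∩ Quad, dist w q < δ →
        |h w - h q| ≤ ε) ∧
      ∀ᶠ k in atTop, ∀ w ∈ Metric.ball x R ∩ Quad, ∀ q ∈ Metric.ball x R ∩ Quad, dist w q < δ →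
        |hk k w - hk k q| ≤ ε)
    {d : Fin 2 → ℝ} (hd : ∀ j, d j = 1 ∨ d j = -1) :
    DisplacedClose h hk d (Metric.ball x (R / 2) ∩ Quad) := by
  intro ε hε
  obtain ⟨δ, hδ, hh, hhk⟩ := hequi (ε / 8) (by positivity)
  have hhalf : Metric.closedBall x (R / 2) ⊆ Metric.ball x R :=
    Metric.closedBall_subset_ball (by linarith)
  have hK : IsCompact (Metric.closedBall x (R / 2) ∩ Quad) :=
    (isCompact_closedBall x (R / 2)).inter_right isClosed_quad
  have hunif : ∀ᶠ k in atTop, ∀ w ∈ Metric.closedBall x (R / 2) ∩ Quad,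
      |hk k w - h w| ≤ ε / 2 := by
    refine hK.induction_on (p := fun S => ∀ᶠ k in atTop, ∀ w ∈ S,
      w ∈ Metric.closedBall x (R / 2) ∩ Quad → |hk k w - h w| ≤ ε / 2) ?_ ?_ ?_ ?_ |>.mono
        fun k hk w hw => hk w hw hw
    · exact Eventually.of_forall fun k w hw => hw.elim
    · exact fun S S' hSS hS' => hS'.mono fun k hk w hw => hk w (hSS hw)
    · intro S S' hS hS'
      filter_upwards [hS, hS'] with k h1 h2 w hw
      exact hw.elim (h1 w) (h2 w)
    · intro y hy
      -- Push `y` into the open quadrant, where the relaxed limits are available.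
      set τ := min (δ / 8) (R / 8) with hτ
      have hτ0 : 0 < τ := by positivity
      set p : Plane := !₂[y 0 + τ, y 1 + τ] with hp
      have hyp : dist p y ≤ 2 * τ := by
        have := dist_le_abs_add_abs p y
        have e0 : p 0 - y 0 = τ := add_sub_cancel_left _ _
        have e1 : p 1 - y 1 = τ := add_sub_cancel_left _ _
        rw [e0, e1, abs_of_pos hτ0] at this
        linarith
      have hpO : p ∈ OpenQuad := fun j => by
        have h0 := hy.2 j
        fin_cases j
        · exact add_pos_of_nonneg_of_pos h0 hτ0
        · exact add_pos_of_nonneg_of_pos h0 hτ0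
      have hpR : p ∈ Metric.ball x R := by
        have h1 := dist_triangle p y x
        have h2 := Metric.mem_closedBall.1 hy.1
        rw [Metric.mem_ball]
        linarith [min_le_right (δ / 8) (R / 8)]
      have hnear : ∀ᶠ u in 𝓝 p, |h u - h p| ≤ ε / 8 := by
        filter_upwards [Metric.isOpen_ball.mem_nhds hpR, isOpen_openQuad.mem_nhds hpO,
          Metric.ball_mem_nhds p hδ] with u h1 h2 h3
        exact hh u ⟨h1, openQuad_subset_quad h2⟩ p ⟨hpR, openQuad_subset_quad hpO⟩ h3
      have e1 := ((eventually_lt_of_relaxedLimits (c := h p + ε / 8) hlim hb hkb hpO).1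
        (hnear.mono fun u hu => by linarith [(abs_le.1 hu).2]) (h p + ε / 4) (by linarith)).curry
      have e2 := ((eventually_lt_of_relaxedLimits (c := h p - ε / 8) hlim hb hkb hpO).2
        (hnear.mono fun u hu => by linarith [(abs_le.1 hu).1]) (h p - ε / 4) (by linarith)).curry
      refine ⟨Metric.ball y (δ / 2), mem_nhdsWithin_of_mem_nhds
        (Metric.ball_mem_nhds y (by positivity)), ?_⟩
      filter_upwards [e1, e2, hhk] with k k1 k2 k3 w hw hwK
      have hwp : dist w p < δ := by
        have h1 := dist_triangle w y p
        have h2 := Metric.mem_ball.1 hw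
        rw [dist_comm y p] at h1
        linarith [min_le_left (δ / 8) (R / 8)]
      have hwN : w ∈ Metric.ball x R ∩ Quad := ⟨hhalf hwK.1, hwK.2⟩
      have hpN : p ∈ Metric.ball x R ∩ Quad := ⟨hpR, openQuad_subset_quad hpO⟩
      have a1 := abs_le.1 (k3 w hwN p hpN hwp)
      have a2 := abs_le.1 (hh w hwN p hpN hwp)
      have a3 : hk k p < h p + ε / 4 := k1.self_of_nhds
      have a4 : h p - ε / 4 < hk k p := k2.self_of_nhds
      rw [abs_le]
      constructor <;> linarith [a1.1, a1.2, a2.1, a2.2]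
  refine ⟨δ / 6, by positivity, fun s hs hsδ => ?_⟩
  filter_upwards [hunif] with k hku w hw q hq hdisp _
  have hdist : dist w q < δ := (dist_le_of_displaced hd hdisp).trans_lt (by linarith)
  have hsub : Metric.ball x (R / 2) ⊆ Metric.closedBall x (R / 2) := Metric.ball_subset_closedBall
  have a1 := abs_le.1 (hh w ⟨hhalf (hsub hw.1), hw.2⟩ q ⟨hhalf (hsub hq.1), hq.2⟩ hdist)
  have a2 := abs_le.1 (hku w ⟨hsub hw.1, hw.2⟩)
  have a3 := abs_le.1 (hku q ⟨hsub hq.1, hq.2⟩)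
  constructor <;> linarith [a1.1, a1.2, a2.1, a2.2, a3.1, a3.2]

/-- A function that is Lipschitz on the two sides `{G > 0}`, `{G < 0}` of an interface, and equal on
the interface to its limit from the positive side, which is the larger one, increases along `G`. -/
lemma increasesAlong_of_jump {G : Plane → ℝ} (hG : Continuous G) {V A B : Set Plane}
    (hV : Convex ℝ V) {C : NNReal} (hA : LipschitzOnWith C h A) (hB : LipschitzOnWith C h B)
    (hVA : ∀ w ∈ V, 0 < G w → w ∈ A) (hVB : ∀ w ∈ V, G w < 0 → w ∈ B)
    (hjump : ∀ y ∈ V, G y = 0 → y ∈ closure A ∧ y ∈ closure B ∧ ∃ a b, Tendsto h (𝓝[A] y) (𝓝 a) ∧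
      Tendsto h (𝓝[B] y) (𝓝 b) ∧ b ≤ a ∧ h y = a) : IncreasesAlong h G V := by
  have hlim : ∀ (S : Set Plane), LipschitzOnWith C h S → ∀ q ∈ S, ∀ y ∈ closure S, ∀ a,
      Tendsto h (𝓝[S] y) (𝓝 a) → |h q - a| ≤ C * dist q y := by
    intro S hS q hq y hy a ha
    have := mem_closure_iff_nhdsWithin_neBot.1 hy
    refine le_of_tendsto_of_tendsto (tendsto_const_nhds.sub ha).abs
      (tendsto_const_nhds.mul (tendsto_const_nhds.dist (tendsto_id.mono_left nhdsWithin_le_nhds)))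
      (eventually_mem_nhdsWithin.mono fun u hu => ?_)
    have := hS.dist_le_mul q hq u hu
    rwa [Real.dist_eq] at this
  have hpos : ∀ q ∈ V, 0 < G q → ∀ y ∈ V, G y = 0 → h y ≤ h q + C * dist y q := by
    intro q hq hGq y hy hGy
    obtain ⟨hyA, -, a, b, ha, -, -, hya⟩ := hjump y hy hGy
    have := (abs_le.1 (hlim A hA q (hVA q hq hGq) y hyA a ha)).1
    rw [hya, dist_comm]
    linarith
  have hneg : ∀ w ∈ V, G w < 0 → ∀ y ∈ V, G y = 0 → h w ≤ h y + C * dist w y := by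
    intro w hw hGw y hy hGy
    obtain ⟨-, hyB, a, b, -, hb, hba, hya⟩ := hjump y hy hGy
    have := (abs_le.1 (hlim B hB w (hVB w hw hGw) y hyB b hb)).2
    rw [hya]
    linarith
  have hlip : ∀ S : Set Plane, LipschitzOnWith C h S → ∀ w ∈ S, ∀ q ∈ S,
      h w ≤ h q + C * dist w q := by
    intro S hS w hw q hq
    have := hS.dist_le_mul w hw q hq
    rw [Real.dist_eq] at this
    linarith [le_abs_self (h w - h q)]
  have key : ∀ w ∈ V, ∀ q ∈ V, G w < G q → h w ≤ h q + C * dist w q := by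
    intro w hw q hq hlt
    rcases lt_trichotomy (G w) 0 with h1 | h1 | h1
    · rcases lt_trichotomy (G q) 0 with h2 | h2 | h2
      · exact hlip B hB w (hVB w hw h1) q (hVB q hq h2)
      · exact hneg w hw h1 q hq h2
      · -- The segment from `w` to `q` crosses the interface.
        obtain ⟨y, hy, hGy⟩ := (convex_segment w q).isPreconnected.intermediate_value
          (left_mem_segment ℝ w q) (right_mem_segment ℝ w q) hG.continuousOn ⟨h1.le, h2.le⟩
        have hyV := hV.segment_subset hw hq hy
        have e1 := hneg w hw h1 y hyV hGy
        have e2 := hpos q hq h2 y hyV hGy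
        rw [← dist_add_dist_of_mem_segment hy]
        linarith
    · exact hpos q hq (h1 ▸ hlt) w hw h1
    · exact hlip A hA w (hVA w hw h1) q (hVA q hq (h1.trans hlt))
  intro ε hε
  refine ⟨ε / (C + 1), by positivity, fun w hw q hq hlt hd => ?_⟩
  have := key w hw q hq hlt
  rw [lt_div_iff₀ (by positivity)] at hd
  nlinarith [dist_nonneg (x := w) (y := q)]

lemma goodAt_of_increasesAlong (hμlim : RelaxedLimits μ μk) (hσlim : RelaxedLimits σ σk)
    (h : Admissible M μ σ) (hk : ∀ᶠ k in atTop, Admissible M (μk k) (σk k)) {x : Plane}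
    {R : ℝ} (hR : 0 < R) (hRQ : Metric.ball x R ⊆ OpenQuad) {g : Plane → ℝ} (hg : Continuous g)
    {d : Fin 2 → ℝ} (hd : ∀ j, d j = 1 ∨ d j = -1)
    (hgd : ∀ w q : Plane, (∀ j, 0 ≤ d j * (q j - w j)) → (∃ j, 0 < d j * (q j - w j)) →
      g w < g q)
    (hμ : IncreasesAlong μ g (Metric.ball x R))
    (hσ : IncreasesAlong (fun x => σ x ^ 2) g (Metric.ball x R)) : GoodAt μ σ μk σk x := by
  have hσ' := hσ.of_sq fun y hy => h.sigma_nonneg y (openQuad_subset_quad (hRQ hy))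
  have hsub : Metric.closedBall x (R / 2) ⊆ Metric.ball x R :=
    Metric.closedBall_subset_ball (by linarith)
  exact goodAt_of_displacedClose (half_pos hR) hd
    (displacedClose_of_increasesAlong hμlim (fun y hy => ⟨h.mu_nonneg y hy, h.mu_le y hy⟩)
      (hk.mono fun k hk y hy => ⟨hk.mu_nonneg y hy, hk.mu_le y hy⟩) Metric.isOpen_ball hRQ hsub hg
      hd (fun w q _ _ => hgd w q) hμ)
    (displacedClose_of_increasesAlong hσlim (fun y hy => ⟨h.sigma_nonneg y hy, h.sigma_le y hy⟩)
      (hk.mono fun k hk y hy => ⟨hk.sigma_nonneg y hy, hk.sigma_le y hy⟩) Metric.isOpen_ball hRQ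
      hsub hg hd (fun w q _ _ => hgd w q) hσ')

namespace Geometry

variable {D : Geometry}

/-- Points of `Ω` are good because all costs vanish near them. -/
lemma goodAt_of_psi_neg (hμ : ∀ x ∈ D.Om, μ x = 0) (hσ : ∀ x ∈ D.Om, σ x ^ 2 = 0)
    (hμk : ∀ k : ℕ, 1 ≤ k → ∀ x ∈ D.OmTrim (1 / (k : ℝ)), μk k x = 0)
    (hσk : ∀ k : ℕ, 1 ≤ k → ∀ x ∈ D.OmTrim (1 / (k : ℝ)), σk k x ^ 2 = 0)
    {x : Plane} (hx : x ∈ Quad) (hpsi : D.psi x < 0) : GoodAt μ σ μk σk x := by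
  have hxG : x ∉ D.Gam := fun hG => hpsi.ne ((D.mem_Gam_iff hx).1 hG)
  have hpos := (D.isClosed_Gam.notMem_iff_infDist_pos D.Gam_nonempty).1 hxG
  obtain ⟨r, hr, hball⟩ := Metric.mem_nhds_iff.1
    ((isOpen_lt D.continuous_psi continuous_const).mem_nhds (show D.psi x < 0 from hpsi))
  set ρ := Metric.infDist x D.Gam with hρ
  set R := min r (ρ / 2) with hRdef
  have hR : 0 < R := lt_min hr (by positivity)
  have hOm : ∀ y ∈ Metric.ball x R ∩ Quad, y ∈ D.Om := fun y hy =>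
    D.mem_Om_iff.2 ⟨hy.2, hball (Metric.ball_subset_ball (min_le_left _ _) hy.1)⟩
  have hsmall : ∀ᶠ k : ℕ in atTop, 1 / (k : ℝ) < ρ / 2 :=
    tendsto_one_div_atTop_nhds_zero_nat.eventually_lt_const (by positivity)
  have hTrim : ∀ᶠ k : ℕ in atTop, 1 ≤ k ∧ ∀ y ∈ Metric.ball x R ∩ Quad,
      y ∈ D.OmTrim (1 / (k : ℝ)) := by
    filter_upwards [hsmall, eventually_ge_atTop 1] with k hk1 hk2
    refine ⟨hk2, fun y hy => ⟨hOm y hy, ?_⟩⟩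
    have h1 := Metric.infDist_le_infDist_add_dist (s := D.Gam) (x := x) (y := y)
    have h2 := Metric.mem_ball'.1 hy.1
    have h3 := min_le_right r (ρ / 2)
    linarith
  refine goodAt_of_displacedClose hR (d := fun _ => 1) (fun _ => Or.inl rfl) ?_ ?_
  · refine fun ε hε => ⟨1, one_pos, fun s _ _ => ?_⟩
    filter_upwards [hTrim] with k hkT w hw q hq _ _
    rw [hμ w (hOm w hw), hμ q (hOm q hq), hμk k hkT.1 w (hkT.2 w hw), hμk k hkT.1 q (hkT.2 q hq)]
    constructor <;> linarith
  · refine fun ε hε => ⟨1, one_pos, fun s _ _ => ?_⟩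
    filter_upwards [hTrim] with k hkT w hw q hq _ _
    rw [pow_eq_zero_iff two_ne_zero |>.1 (hσ w (hOm w hw)),
      pow_eq_zero_iff two_ne_zero |>.1 (hσ q (hOm q hq)),
      pow_eq_zero_iff two_ne_zero |>.1 (hσk k hkT.1 w (hkT.2 w hw)),
      pow_eq_zero_iff two_ne_zero |>.1 (hσk k hkT.1 q (hkT.2 q hq))]
    constructor <;> linarith

/-- Points of a region strictly above `Γ` are good, even on the axes, by equicontinuity. -/
lemma goodAt_of_psi_pos (hμlim : RelaxedLimits μ μk) (hσlim : RelaxedLimits σ σk)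
    (h : Admissible M μ σ) (hk : ∀ᶠ k in atTop, Admissible M (μk k) (σk k)) {C C' : NNReal}
    (hμ : ∀ i, LipschitzOnWith C μ (D.region i))
    (hσ : ∀ i, LipschitzOnWith C (fun x => σ x ^ 2) (D.region i))
    (hμk : ∀ k : ℕ, 1 ≤ k → ∀ i, LipschitzOnWith C' (μk k) (D.regionTrim i (1 / (k : ℝ))))
    (hσk : ∀ k : ℕ, 1 ≤ k → ∀ i,
      LipschitzOnWith C' (fun x => σk k x ^ 2) (D.regionTrim i (1 / (k : ℝ))))
    {x : Plane} (hx : x ∈ Quad) (hpsi : 0 < D.psi x) (hcurve : x ∉ ⋃ i, D.curve i) :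
    GoodAt μ σ μk σk x := by
  have hxF : x ∈ D.free := ⟨D.mem_outer_iff.2 ⟨hx, hpsi.le⟩, hcurve⟩
  obtain ⟨i, hi⟩ := mem_iUnion.1 (D.region_cover hxF)
  obtain ⟨r, hr, hball⟩ := Metric.mem_nhds_iff.1 (inter_mem
    ((isOpen_lt continuous_const D.continuous_psi).mem_nhds (show 0 < D.psi x from hpsi))
    (D.isClosed_iUnion_curve.isOpen_compl.mem_nhds hcurve))
  have hpos : ∀ j, 0 < Metric.infDist x (D.curve j) := fun j =>
    ((D.isClosed_curve j).notMem_iff_infDist_pos ⟨_, D.start_mem_curve j⟩).1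
      fun hj => hcurve (mem_iUnion.2 ⟨j, hj⟩)
  set ρ := min (Metric.infDist x (D.curve i)) (Metric.infDist x (D.curve (i + 1))) with hρ
  have hρ0 : 0 < ρ := lt_min (hpos _) (hpos _)
  set R := min r (ρ / 2) with hRdef
  have hR : 0 < R := lt_min hr (by positivity)
  have hquad : Convex ℝ Quad := by
    intro w hw q hq a b ha hb _ j
    have := hw j
    have := hq j
    simp only [PiLp.add_apply, PiLp.smul_apply, smul_eq_mul]
    positivity
  have hreg : Metric.ball x R ∩ Quad ⊆ D.region i := by
    refine D.subset_region ((convex_ball x R).inter hquad).isPreconnected (fun y hy => ?_)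
      ⟨Metric.mem_ball_self hR, hx⟩ hi
    have := hball (Metric.ball_subset_ball (min_le_left _ _) hy.1)
    exact ⟨D.mem_outer_iff.2 ⟨hy.2, le_of_lt this.1⟩, this.2⟩
  have hsmall : ∀ᶠ k : ℕ in atTop, 1 / (k : ℝ) < ρ / 2 :=
    tendsto_one_div_atTop_nhds_zero_nat.eventually_lt_const (by positivity)
  have hTrim : ∀ᶠ k : ℕ in atTop, 1 ≤ k ∧
      Metric.ball x R ∩ Quad ⊆ D.regionTrim i (1 / (k : ℝ)) := by
    filter_upwards [hsmall, eventually_ge_atTop 1] with k hk1 hk2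
    refine ⟨hk2, fun y hy => ⟨hreg hy, ?_, ?_⟩⟩
    · have h1 := Metric.infDist_le_infDist_add_dist (s := D.curve i) (x := x) (y := y)
      have h2 := Metric.mem_ball'.1 hy.1
      linarith [min_le_right r (ρ / 2),
        min_le_left (Metric.infDist x (D.curve i)) (Metric.infDist x (D.curve (i + 1)))]
    · have h1 := Metric.infDist_le_infDist_add_dist (s := D.curve (i + 1)) (x := x) (y := y)
      have h2 := Metric.mem_ball'.1 hy.1
      linarith [min_le_right r (ρ / 2),
        min_le_right (Metric.infDist x (D.curve i)) (Metric.infDist x (D.curve (i + 1)))]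
  have hd : ∀ j : Fin 2, (fun _ => (1 : ℝ)) j = 1 ∨ (fun _ => (1 : ℝ)) j = -1 :=
    fun _ => Or.inl rfl
  refine goodAt_of_displacedClose (half_pos hR) hd
    (displacedClose_of_equicontinuous hμlim (fun y hy => ⟨h.mu_nonneg y hy, h.mu_le y hy⟩)
      (hk.mono fun k hk y hy => ⟨hk.mu_nonneg y hy, hk.mu_le y hy⟩) hR ?_ hd)
    (displacedClose_of_equicontinuous hσlim (fun y hy => ⟨h.sigma_nonneg y hy, h.sigma_le y hy⟩)
      (hk.mono fun k hk y hy => ⟨hk.sigma_nonneg y hy, hk.sigma_le y hy⟩) hR ?_ hd)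
  · intro ε hε
    obtain ⟨δ, hδ, H⟩ := exists_lipschitz_modulus C hε
    obtain ⟨δ', hδ', H'⟩ := exists_lipschitz_modulus C' hε
    refine ⟨min δ δ', lt_min hδ hδ', fun w hw q hq hd => H _ _ ((hμ i).mono hreg) w hw q hq
      (hd.trans_le (min_le_left _ _)), ?_⟩
    filter_upwards [hTrim] with k hkT w hw q hq hd
    exact H' _ _ ((hμk k hkT.1 i).mono hkT.2) w hw q hq (hd.trans_le (min_le_right _ _))
  · intro ε hε
    obtain ⟨δ, hδ, H⟩ := exists_lipschitz_modulus C (show 0 < ε ^ 2 by positivity)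
    obtain ⟨δ', hδ', H'⟩ := exists_lipschitz_modulus C' (show 0 < ε ^ 2 by positivity)
    refine ⟨min δ δ', lt_min hδ hδ', fun w hw q hq hd => ?_, ?_⟩
    · exact abs_sub_le_of_abs_sq_sub_sq_le (h.sigma_nonneg w hw.2) (h.sigma_nonneg q hq.2) hε.le
        (H _ _ ((hσ i).mono hreg) w hw q hq (hd.trans_le (min_le_left _ _)))
    · filter_upwards [hTrim, hk] with k hkT hka w hw q hq hd
      exact abs_sub_le_of_abs_sq_sub_sq_le (hka.sigma_nonneg w hw.2) (hka.sigma_nonneg q hq.2)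
        hε.le (H' _ _ ((hσk k hkT.1 i).mono hkT.2) w hw q hq (hd.trans_le (min_le_right _ _)))

/-- Points of `Γ` in the open quadrant that lie on no `Γ_i` are good: the costs increase when the
point is displaced upwards to the right, from `Ω` into a region. -/
lemma goodAt_of_psi_zero (hμlim : RelaxedLimits μ μk) (hσlim : RelaxedLimits σ σk)
    (h : Admissible M μ σ) (hk : ∀ᶠ k in atTop, Admissible M (μk k) (σk k)) {C : NNReal}
    (hμ0 : ∀ x ∈ D.Om, μ x = 0) (hσ0 : ∀ x ∈ D.Om, σ x ^ 2 = 0)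
    (hμ : ∀ i, LipschitzOnWith C μ (D.region i))
    (hσ : ∀ i, LipschitzOnWith C (fun x => σ x ^ 2) (D.region i))
    {x : Plane} (hx : x ∈ OpenQuad) (hpsi : D.psi x = 0) (hcurve : x ∉ ⋃ i, D.curve i) :
    GoodAt μ σ μk σk x := by
  set F : ℝ → ℝ := fun t => -extendMono 0 1 (fun t => -D.g t) t with hF
  have hxF : x 1 = F (x 0) := sub_eq_zero.1 hpsi
  obtain ⟨r, hr, hsub⟩ := exists_strip_subset D.continuous_negExtend hxF
    (inter_mem (isOpen_openQuad.mem_nhds hx) (D.isClosed_iUnion_curve.isOpen_compl.mem_nhds hcurve))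
  have hfree : strip F x r (Ici 0) ⊆ D.free := fun w hw =>
    ⟨D.mem_outer_iff.2 ⟨openQuad_subset_quad (hsub (strip_subset_univ hw)).1, hw.2.2⟩,
      (hsub (strip_subset_univ hw)).2⟩
  obtain ⟨i, hi⟩ := D.exists_subset_region
    (isPreconnected_strip D.continuous_negExtend ordConnected_Ici) hfree
    ⟨x, mem_strip_self hr hxF (mem_Ici.2 le_rfl)⟩
  obtain ⟨R, hR, hball⟩ := Metric.mem_nhds_iff.1
    ((isOpen_strip D.continuous_negExtend).mem_nhds (mem_strip_self hr hxF (mem_univ 0)))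
  have hinc : ∀ f : Plane → ℝ, (∀ y ∈ Quad, 0 ≤ f y) → (∀ y ∈ D.Om, f y = 0) →
      LipschitzOnWith C f (D.region i) → IncreasesAlong f D.psi (Metric.ball x R) := by
    intro f hf0 hfOm hL ε hε
    obtain ⟨δ, hδ, H⟩ := exists_lipschitz_modulus C hε
    refine ⟨δ, hδ, fun w hw q hq hlt hd => ?_⟩
    have hwQ := openQuad_subset_quad (hsub (hball hw)).1
    have hqQ := openQuad_subset_quad (hsub (hball hq)).1
    rcases lt_or_ge (D.psi w) 0 with hw0 | hw0
    · rw [hfOm w (D.mem_Om_iff.2 ⟨hwQ, hw0⟩)]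
      linarith [hf0 q hqQ]
    · have hmem : ∀ y ∈ Metric.ball x R, 0 ≤ D.psi y → y ∈ D.region i := fun y hy hy0 =>
        hi ⟨(hball hy).1, (hball hy).2.1, hy0⟩
      have := H f _ hL w (hmem w hw hw0) q (hmem q hq (hw0.trans hlt.le)) hd
      linarith [(abs_le.1 this).2]
  refine goodAt_of_increasesAlong hμlim hσlim h hk hR (fun y hy => (hsub (hball hy)).1)
    D.continuous_psi (d := fun _ => 1) (fun _ => Or.inl rfl) ?_
    (hinc μ h.mu_nonneg hμ0 (hμ i)) (hinc _ (fun y _ => sq_nonneg _) hσ0 (hσ i))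
  rintro w q h1 ⟨j, hj⟩
  exact D.psi_lt (fun j => by linarith [h1 j]) ⟨j, by linarith⟩

/-- The limits in the maximum condition and those in the jump condition agree, as both adjacent
regions accumulate at every point of `Γ_i`. -/
lemma exists_limits_of_signedJump {h : Plane → ℝ} {i : ℤ} {y : Plane} (hy : y ∈ D.curve i)
    (hmax : MaxOnCurves D h) {ζ : ℝ} (hjump : SignedJumpNonneg D i ζ h y) :
    ∃ a b, Tendsto h (𝓝[D.region (i - 1)] y) (𝓝 a) ∧ Tendsto h (𝓝[D.region i] y) (𝓝 b) ∧
      h y = max a b ∧ 0 ≤ ζ * (a - b) := by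
  have hcl : ∀ j, j = i ∨ j = i - 1 → (𝓝[D.region j] y).NeBot := fun j hj =>
    mem_closure_iff_nhdsWithin_neBot.1 (frontier_subset_closure ((D.region_label i j).2 hj hy))
  have := hcl i (Or.inl rfl)
  have := hcl (i - 1) (Or.inr rfl)
  obtain ⟨a, b, ha, hb, hab⟩ := hmax i y hy
  obtain ⟨a', b', ha', hb', hab'⟩ := hjump
  rw [tendsto_nhds_unique ha' ha, tendsto_nhds_unique hb' hb] at hab'
  exact ⟨a, b, ha, hb, hab, hab'⟩

/-- Points of `Γ_i` other than its endpoint are good: the costs increase when the point is displaced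
transversally to `Γ_i`, towards the side selected by the common sign of the jumps. -/
lemma goodAt_of_mem_curve (hμlim : RelaxedLimits μ μk) (hσlim : RelaxedLimits σ σk)
    (h : Admissible M μ σ) (hk : ∀ᶠ k in atTop, Admissible M (μk k) (σk k)) {C : NNReal}
    (hμ : ∀ i, LipschitzOnWith C μ (D.region i))
    (hσ : ∀ i, LipschitzOnWith C (fun x => σ x ^ 2) (D.region i))
    (hF3 : SimultaneousF3 D μ (fun x => σ x ^ 2)) (hμmax : MaxOnCurves D μ)
    (hσmax : MaxOnCurves D (fun x => σ x ^ 2)) {i : ℤ} {x : Plane} (hx : x ∈ D.curve i)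
    (hne : x 0 ≠ D.start i) : GoodAt μ σ μk σk x := by
  obtain ⟨ε, hε, ζ, hζ, hjump⟩ := hF3 i x hx
  have hsides : ∃ A B : ℤ, ((A = i ∧ B = i - 1) ∨ (A = i - 1 ∧ B = i)) ∧ ∀ f : Plane → ℝ,
      MaxOnCurves D f → ∀ y ∈ D.curve i, SignedJumpNonneg D i ζ f y →
      ∃ a b, Tendsto f (𝓝[D.region A] y) (𝓝 a) ∧ Tendsto f (𝓝[D.region B] y) (𝓝 b) ∧
        b ≤ a ∧ f y = a := by
    rcases hζ with rfl | rfl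
    · refine ⟨i - 1, i, Or.inr ⟨rfl, rfl⟩, fun f hf y hy hj => ?_⟩
      obtain ⟨a, b, ha, hb, he, hs⟩ := exists_limits_of_signedJump hy hf hj
      have hba : b ≤ a := by linarith
      exact ⟨a, b, ha, hb, hba, he.trans (max_eq_left hba)⟩
    · refine ⟨i, i - 1, Or.inl ⟨rfl, rfl⟩, fun f hf y hy hj => ?_⟩
      obtain ⟨a, b, ha, hb, he, hs⟩ := exists_limits_of_signedJump hy hf hj
      have hab : a ≤ b := by linarith
      exact ⟨b, a, hb, ha, hab, he.trans (max_eq_right hab)⟩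
  obtain ⟨A, B, hAB, hlims⟩ := hsides
  obtain ⟨F, hFc, hFm, hxF, r, hr, hsub, hon, hreg⟩ := D.exists_strip_curve hx hne
    (inter_mem (Metric.ball_mem_nhds x hε)
      (isOpen_openQuad.mem_nhds (D.interior_of_mem_curve hx hne).1))
  -- `κ` orients the height above the curve so that it is positive on the better side.
  obtain ⟨κ, hκ, hpos, hneg⟩ : ∃ κ : ℝ, (κ = 1 ∨ κ = -1) ∧
      (∀ w ∈ strip F x r univ, 0 < κ * (w 1 - F (w 0)) → w ∈ D.region A) ∧
      (∀ w ∈ strip F x r univ, κ * (w 1 - F (w 0)) < 0 → w ∈ D.region B) := by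
    rcases hAB with ⟨rfl, rfl⟩ | ⟨rfl, rfl⟩ <;> rcases hreg with ⟨h1, h2⟩ | ⟨h1, h2⟩
    · exact ⟨1, Or.inl rfl, fun w hw h0 => h1 ⟨hw.1, hw.2.1, by rw [mem_Ioi]; linarith⟩,
        fun w hw h0 => h2 ⟨hw.1, hw.2.1, by rw [mem_Iio]; linarith⟩⟩
    · exact ⟨-1, Or.inr rfl, fun w hw h0 => h2 ⟨hw.1, hw.2.1, by rw [mem_Iio]; linarith⟩,
        fun w hw h0 => h1 ⟨hw.1, hw.2.1, by rw [mem_Ioi]; linarith⟩⟩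
    · exact ⟨-1, Or.inr rfl, fun w hw h0 => h2 ⟨hw.1, hw.2.1, by rw [mem_Iio]; linarith⟩,
        fun w hw h0 => h1 ⟨hw.1, hw.2.1, by rw [mem_Ioi]; linarith⟩⟩
    · exact ⟨1, Or.inl rfl, fun w hw h0 => h1 ⟨hw.1, hw.2.1, by rw [mem_Ioi]; linarith⟩,
        fun w hw h0 => h2 ⟨hw.1, hw.2.1, by rw [mem_Iio]; linarith⟩⟩
  have hκ0 : κ ≠ 0 := by rcases hκ with rfl | rfl <;> norm_num
  obtain ⟨R, hR, hball⟩ := Metric.mem_nhds_iff.1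
    ((isOpen_strip hFc).mem_nhds (mem_strip_self hr hxF (mem_univ 0)))
  have hGc : Continuous fun w : Plane => κ * (w 1 - F (w 0)) :=
    continuous_const.mul (continuous_height hFc)
  have hinc : ∀ f : Plane → ℝ, MaxOnCurves D f → (∀ j, LipschitzOnWith C f (D.region j)) →
      (∀ y ∈ Metric.ball x ε ∩ D.curve i, SignedJumpNonneg D i ζ f y) →
      IncreasesAlong f (fun w : Plane => κ * (w 1 - F (w 0))) (Metric.ball x R) := by
    intro f hf hL hj
    refine increasesAlong_of_jump hGc (convex_ball x R) (hL A) (hL B)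
      (fun w hw => hpos w (hball hw)) (fun w hw => hneg w (hball hw)) fun y hy hy0 => ?_
    have hyc := hon y (hball hy) ((mul_eq_zero.1 hy0).resolve_left hκ0)
    have hcl : ∀ j, j = i ∨ j = i - 1 → y ∈ closure (D.region j) := fun j hj =>
      frontier_subset_closure ((D.region_label i j).2 hj hyc)
    refine ⟨hcl A (by tauto), hcl B (by tauto),
      hlims f hf y hyc (hj y ⟨(hsub (hball hy)).1, hyc⟩)⟩
  refine goodAt_of_increasesAlong hμlim hσlim h hk hR (fun y hy => (hsub (hball hy)).2) hGc
    (d := ![-κ, κ]) ?_ ?_ (hinc μ hμmax hμ fun y hy => (hjump y hy).1)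
    (hinc _ hσmax hσ fun y hy => (hjump y hy).2)
  · intro j
    fin_cases j <;> rcases hκ with rfl | rfl <;> simp
  · intro w q h1 h2
    have a0 : 0 ≤ -κ * (q 0 - w 0) := h1 0
    have a1 : 0 ≤ κ * (q 1 - w 1) := h1 1
    have hcase : 0 < -κ * (q 0 - w 0) ∨ 0 < κ * (q 1 - w 1) := by
      obtain ⟨j, hj⟩ := h2
      fin_cases j
      · exact Or.inl hj
      · exact Or.inr hj
    rcases hκ with rfl | rfl
    · have m := hFm.monotone (show q 0 ≤ w 0 by linarith)
      rcases hcase with hc | hc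
      · have := hFm (show q 0 < w 0 by linarith)
        linarith
      · linarith
    · have m := hFm.monotone (show w 0 ≤ q 0 by linarith)
      rcases hcase with hc | hc
      · have := hFm (show w 0 < q 0 by linarith)
        linarith
      · linarith

/-- The levels of the points that may fail to be good: the endpoints of `Γ` and of the curves
`Γ_i`. -/
lemma exists_finset_levels (D : Geometry) (T : ℝ) : ∃ B : Finset ℝ, 1 ∈ B ∧
    ∀ i, ∀ x ∈ D.curve i, x ∈ Quad → level x ≤ T → x 0 = D.start i → level x ∈ B := by
  have hfin := D.curves_locallyFinite.finite_nonempty_inter_compact (isCompact_level_le T)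
  refine ⟨insert 1 (hfin.toFinset.image fun i => D.start i + D.f i (D.start i)),
    Finset.mem_insert_self _ _, fun i x hx hxQ hxT h0 => Finset.mem_insert_of_mem ?_⟩
  refine Finset.mem_image.2 ⟨i, hfin.mem_toFinset.2 ⟨x, hx, hxQ, hxT⟩, ?_⟩
  rw [level, hx.2, h0]

lemma mem_openQuad_of_psi_zero {x : Plane} (hx : x ∈ Quad) (hpsi : D.psi x = 0)
    (hlevel : level x ≠ 1) : x ∈ OpenQuad := by
  obtain ⟨h0, h1⟩ := (D.mem_Gam_iff hx).2 hpsi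
  intro j
  refine lt_of_le_of_ne (hx j) fun hj => hlevel ?_
  fin_cases j
  · have e : x 0 = 0 := hj.symm
    rw [level, h1, e, D.g_zero, zero_add]
  · have e : x 1 = 0 := hj.symm
    rw [e, ← D.g_one] at h1
    have := D.g_anti.injOn ⟨zero_le_one, le_rfl⟩ h0 h1
    rw [level, e, ← this, add_zero]

end Geometry

end Sequences

lemma upperSemicontinuousOn_of_sq {σ : Plane → ℝ} (hσ : ∀ x ∈ Quad, 0 ≤ σ x)
    (h : UpperSemicontinuousOn (fun x => σ x ^ 2) Quad) : UpperSemicontinuousOn σ Quad := by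
  intro x hx c hc
  have hc0 : 0 < c := (hσ x hx).trans_lt hc
  filter_upwards [h x hx (c ^ 2) (pow_lt_pow_left₀ hc (hσ x hx) two_ne_zero)] with y hy
  exact lt_of_pow_lt_pow_left₀ 2 hc0.le hy

lemma le_add_one_of_sq_le {a M : ℝ} (h : a ^ 2 ≤ M) : a ≤ M + 1 := by
  nlinarith [sq_nonneg (a - 1)]

end DLPP

open DLPP in
theorem mainTheorem3 (D : DLPP.Geometry) (μ σ : DLPP.Plane → ℝ) (μk σk : ℕ → DLPP.Plane → ℝ)
    (hσ : ∀ x ∈ DLPP.Quad, 0 ≤ σ x)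
    (hzeros : ∀ x ∈ DLPP.OpenQuad, σ x = 0 → μ x = 0)
    (hμF1 : DLPP.F1 D μ) (hσF1 : DLPP.F1 D (fun x => σ x ^ 2))
    (hF3 : DLPP.SimultaneousF3 D μ (fun x => σ x ^ 2))
    (hμmax : DLPP.MaxOnCurves D μ) (hσmax : DLPP.MaxOnCurves D (fun x => σ x ^ 2))
    (hσk : ∀ k ≥ 1, ∀ x ∈ DLPP.Quad, 0 ≤ σk k x)
    (hLip : ∀ k ≥ 1, DLPP.LipschitzOnQuad (μk k) ∧ DLPP.LipschitzOnQuad (fun x => σk k x ^ 2))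
    (hF1Star : ∃ (C : NNReal) (M : ℝ), ∀ k : ℕ, k ≥ 1 →
      DLPP.F1Star D (1 / (k : ℝ)) C M (μk k) ∧
        DLPP.F1Star D (1 / (k : ℝ)) C M (fun x => σk k x ^ 2))
    (hμlim : DLPP.RelaxedLimits μ μk) (hσlim : DLPP.RelaxedLimits σ σk) :
    ∀ z ∈ DLPP.Quad,
      TendstoLocallyUniformlyOn (fun k x => DLPP.W (μk k) (σk k) z x) (DLPP.W μ σ z) atTop
        (DLPP.Above z) := by
  obtain ⟨hμ0, ⟨M₁, hM₁⟩, hμusc, hμOm, C₁, hC₁⟩ := hμF1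
  obtain ⟨-, ⟨M₂, hM₂⟩, hσusc, hσOm, C₂, hC₂⟩ := hσF1
  obtain ⟨C', M₃, hstar⟩ := hF1Star
  set M := |M₁| + |M₂| + |M₃| + 1 with hM
  have b1 := le_abs_self M₁
  have b2 := le_abs_self M₂
  have b3 := le_abs_self M₃
  have p1 := abs_nonneg M₁
  have p2 := abs_nonneg M₂
  have p3 := abs_nonneg M₃
  have hadm : Admissible M μ σ := ⟨hμ0, hσ, fun x hx => by linarith [hM₁ x hx],
    fun x hx => by linarith [le_add_one_of_sq_le (hM₂ x hx)], hμusc,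
    upperSemicontinuousOn_of_sq hσ hσusc⟩
  have hadmk : ∀ᶠ k in atTop, Admissible M (μk k) (σk k) := by
    filter_upwards [eventually_ge_atTop 1] with k hk
    obtain ⟨⟨s1, s2, s3, -, -⟩, -, t2, t3, -, -⟩ := hstar k hk
    exact ⟨s1, hσk k hk, fun x hx => by linarith [s2 x hx],
      fun x hx => by linarith [le_add_one_of_sq_le (t2 x hx)], s3,
      upperSemicontinuousOn_of_sq (hσk k hk) t3⟩
  have hC₁' : ∀ i, LipschitzOnWith (max C₁ C₂) μ (D.region i) := fun i =>
    (hC₁ i).weaken (le_max_left _ _)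
  have hC₂' : ∀ i, LipschitzOnWith (max C₁ C₂) (fun x => σ x ^ 2) (D.region i) := fun i =>
    (hC₂ i).weaken (le_max_right _ _)
  have hgood : ∀ T : ℝ, ∃ B : Finset ℝ, ∀ x ∈ Quad, level x ≤ T → level x ∉ B →
      GoodAt μ σ μk σk x := by
    intro T
    obtain ⟨B, h1B, hB⟩ := D.exists_finset_levels T
    refine ⟨B, fun x hx hxT hxB => ?_⟩
    by_cases hcurve : x ∈ ⋃ i, D.curve i
    · obtain ⟨i, hi⟩ := mem_iUnion.1 hcurve
      exact Geometry.goodAt_of_mem_curve hμlim hσlim hadm hadmk hC₁' hC₂' hF3 hμmax hσmax hi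
        fun h0 => hxB (hB i x hi hx hxT h0)
    · rcases lt_trichotomy (D.psi x) 0 with hpsi | hpsi | hpsi
      · exact Geometry.goodAt_of_psi_neg hμOm hσOm (fun k hk => (hstar k hk).1.2.2.2.1)
          (fun k hk => (hstar k hk).2.2.2.2.1) hx hpsi
      · exact Geometry.goodAt_of_psi_zero hμlim hσlim hadm hadmk hμOm hσOm hC₁' hC₂'
          (Geometry.mem_openQuad_of_psi_zero hx hpsi fun h => hxB (h ▸ h1B)) hpsi hcurve
      · exact Geometry.goodAt_of_psi_pos hμlim hσlim hadm hadmk hC₁' hC₂'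
          (fun k hk => (hstar k hk).1.2.2.2.2) (fun k hk => (hstar k hk).2.2.2.2.2) hx hpsi hcurve
  intro z hz
  rw [Metric.tendstoLocallyUniformlyOn_iff]
  intro ε hε x _
  obtain ⟨B, hB⟩ := hgood (level x + 1)
  refine ⟨{y | level y < level x + 1} ∩ Above z, ?_, ?_⟩
  · rw [inter_comm]
    exact inter_mem_nhdsWithin _
      ((isOpen_lt continuous_level continuous_const).mem_nhds (lt_add_one (level x)))
  filter_upwards [eventually_abs_W_sub_W_le hadm hadmk hB (half_pos hε)] with k hk y hy
  rw [dist_comm, Real.dist_eq]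
  exact (hk z hz y hy.2 (le_of_lt hy.1)).trans_lt (half_lt_self hε)
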